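/- Let $d,m$ be positive integers, $\mu>0$, $M\ge 0$ and $c_0>0$. There exist $\kappa\in(0,1/2)$ and $C>0$, depending only on $d,m,\mu,M,c_0$, such that the following holds. Let $\Omega\subset\mathbb R^d$ be a bounded Lipschitz domain with Lipschitz character $(M,c_0)$, that is, a bounded open set (not necessarily connected) such that for every $x_0\in\partial\Omega$ there are a rotated Cartesian coordinate system $(x',x_d)$ and a function $\psi:\mathbb R^{d-1}\to\mathbb R$ with Lipschitz constant at most $M$ for which $$\Omega\cap B(x_0,r_0)=\{(x',x_d):x_d>\psi(x')\}\cap B(x_0,r_0),\qquad r_0=c_0\operatorname{diam}(\Omega).$$ Let $A=(a_{ij}^{\alpha\beta})$, $1\le i,j\le d$, $1\le\alpha,\beta\le m$, be real-valued measurable functions on $\mathbb R^d$ such that, for a.e. $y\in\mathbb R^d$, $$\mu|\xi|^2\le a_{ij}^{\alpha\beta}(y)\,\xi_i^\alpha\xi_j^\beta\quad\text{for all }\xi=(\xi_i^\alpha)\in\mathbb R^{m\times d},\qquad |a_{ij}^{\alpha\beta}(y)|\le\mu^{-1}\quad\text{for all } i,j,\alpha,\beta$$ (repeated indices are summed in the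 first inequality). Let $f=(f_i^\alpha)\in L^2(\Omega;\mathbb R^{m\times d})$, and let $u\in H^1_0(\Omega;\mathbb R^m)$ be a weak solution of $-\operatorname{div}(A\nabla u)=\operatorname{div}(f)$ in $\Omega$, i.e. $$\int_\Omega a_{ij}^{\alpha\beta}\,\partial_ju^\beta\,\partial_i\varphi^\alpha\,dx=-\int_\Omega f_i^\alpha\,\partial_i\varphi^\alpha\,dx\qquad\text{for all }\varphi\in C_c^\infty(\Omega;\mathbb R^m).$$ Then for every real $\sigma$ with $|\sigma|\le 2\kappa$, $$\int_\Omega|\nabla u|^2\,[\operatorname{dist}(x,\partial\Omega)]^\sigma\,dx\le C\int_\Omega|f|^2\,[\operatorname{dist}(x,\partial\Omega)]^\sigma\,dx,$$ where the integrals take values in $[0,\infty]$. -/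

import Mathlib

open MeasureTheory
open scoped NNReal ENNReal ContDiff

/-- Bounded open sets of Lipschitz character `(M, c₀)` in `ℝ^d`: for every boundary point `x₀` there
is a Cartesian coordinate system `(x', x_d)`, with `x_d = ⟪e, x⟫` for a unit vector `e` and `x'` the
orthogonal projection of `x` to the hyperplane `e^⊥`, and a function `ψ` on that hyperplane with
Lipschitz constant at most `M`, such that inside the ball `B(x₀, c₀ diam Ω)` the set `Ω` is
`{x_d > ψ(x')}`. -/
structure IsBoundedLipschitz {d : ℕ} (M : ℝ≥0) (c₀ : ℝ)
    (Ω : Set (EuclideanSpace ℝ (Fin d))) : Prop where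
  isOpen : IsOpen Ω
  isBounded : Bornology.IsBounded Ω
  exists_graph : ∀ x₀ ∈ frontier Ω, ∃ (e : EuclideanSpace ℝ (Fin d)) (ψ : (ℝ ∙ e)ᗮ → ℝ),
    ‖e‖ = 1 ∧ LipschitzWith M ψ ∧
      Ω ∩ Metric.ball x₀ (c₀ * Metric.diam Ω) =
        {x | ψ ((ℝ ∙ e)ᗮ.orthogonalProjectionOnto x) < inner ℝ e x} ∩
          Metric.ball x₀ (c₀ * Metric.diam Ω)

/-- The tensor `A = (a_{ij}^{αβ})`, written `A α β i j`, is measurable and satisfies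
`μ |ξ|² ≤ a_{ij}^{αβ}(y) ξ_i^α ξ_j^β` and `|a_{ij}^{αβ}(y)| ≤ μ⁻¹` for a.e. `y` and all `ξ`. -/
structure IsElliptic {d m : ℕ} (μ : ℝ)
    (A : Fin m → Fin m → Fin d → Fin d → EuclideanSpace ℝ (Fin d) → ℝ) : Prop where
  aemeasurable : ∀ α β i j, AEMeasurable (A α β i j) volume
  coercive : ∀ᵐ y : EuclideanSpace ℝ (Fin d), ∀ ξ : Fin m → Fin d → ℝ,
    μ * ∑ α, ∑ i, ξ α i ^ 2 ≤ ∑ α, ∑ β, ∑ i, ∑ j, A α β i j y * ξ α i * ξ β j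
  bounded : ∀ᵐ y : EuclideanSpace ℝ (Fin d), ∀ α β i j, |A α β i j y| ≤ μ⁻¹

/-- Real-valued functions in `C_c^∞(Ω)`. -/
structure IsTestFunction {d : ℕ} (Ω : Set (EuclideanSpace ℝ (Fin d)))
    (φ : EuclideanSpace ℝ (Fin d) → ℝ) : Prop where
  contDiff : ContDiff ℝ ∞ φ
  hasCompactSupport : HasCompactSupport φ
  tsupport_subset : tsupport φ ⊆ Ω

/-- The classical partial derivative `∂φ/∂x_i`. -/
noncomputable def partialDeriv {d : ℕ} (i : Fin d) (φ : EuclideanSpace ℝ (Fin d) → ℝ)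
    (x : EuclideanSpace ℝ (Fin d)) : ℝ :=
  fderiv ℝ φ x (EuclideanSpace.single i 1)

/-- `g = (g_1, …, g_d)` is the weak gradient of `u` in `Ω`. -/
def IsWeakGradient {d : ℕ} (Ω : Set (EuclideanSpace ℝ (Fin d)))
    (u : EuclideanSpace ℝ (Fin d) → ℝ) (g : Fin d → EuclideanSpace ℝ (Fin d) → ℝ) : Prop :=
  ∀ φ, IsTestFunction Ω φ → ∀ i,
    ∫ x in Ω, u x * partialDeriv i φ x = -∫ x in Ω, g i x * φ x

/-- `u` belongs to the Sobolev space `H¹(Ω)`, and `g` is its weak gradient. -/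
structure MemH1 {d : ℕ} (Ω : Set (EuclideanSpace ℝ (Fin d)))
    (u : EuclideanSpace ℝ (Fin d) → ℝ) (g : Fin d → EuclideanSpace ℝ (Fin d) → ℝ) : Prop where
  memLp : MemLp u 2 (volume.restrict Ω)
  grad_memLp : ∀ i, MemLp (g i) 2 (volume.restrict Ω)
  isWeakGradient : IsWeakGradient Ω u g

/-- `u` belongs to `H¹₀(Ω)`, the closure of `C_c^∞(Ω)` in `H¹(Ω)`, and `g` is its weak gradient. -/
structure MemH10 {d : ℕ} (Ω : Set (EuclideanSpace ℝ (Fin d)))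
    (u : EuclideanSpace ℝ (Fin d) → ℝ) (g : Fin d → EuclideanSpace ℝ (Fin d) → ℝ) : Prop where
  memH1 : MemH1 Ω u g
  mem_closure : ∀ ε : ℝ≥0∞, 0 < ε → ∃ φ, IsTestFunction Ω φ ∧
    eLpNorm (u - φ) 2 (volume.restrict Ω) ≤ ε ∧
    ∀ i, eLpNorm (g i - partialDeriv i φ) 2 (volume.restrict Ω) ≤ ε

/-- The weak form, on test functions, of the system `-div(A∇u) = div f` in `Ω`, where
`G α i = ∂u^α/∂x_i` and `f = (f_i^α)`:
`∫_Ω a_{ij}^{αβ} ∂_j u^β ∂_i φ^α = -∫_Ω f_i^α ∂_i φ^α` for all `φ ∈ C_c^∞(Ω; ℝ^m)`. -/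
def IsWeakSolution {d m : ℕ} (Ω : Set (EuclideanSpace ℝ (Fin d)))
    (A : Fin m → Fin m → Fin d → Fin d → EuclideanSpace ℝ (Fin d) → ℝ)
    (G f : Fin m → Fin d → EuclideanSpace ℝ (Fin d) → ℝ) : Prop :=
  ∀ φ : Fin m → EuclideanSpace ℝ (Fin d) → ℝ, (∀ α, IsTestFunction Ω (φ α)) →
    ∫ x in Ω, ∑ α, ∑ β, ∑ i, ∑ j, A α β i j x * G β j x * partialDeriv i (φ α) x =
      -∫ x in Ω, ∑ α, ∑ i, f α i x * partialDeriv i (φ α) x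

/-- `∫_Ω |F|² dist(x, ∂Ω)^σ dx`, as an element of `[0, ∞]`. -/
noncomputable def weightedEnergy {d m : ℕ} (Ω : Set (EuclideanSpace ℝ (Fin d))) (σ : ℝ)
    (F : Fin m → Fin d → EuclideanSpace ℝ (Fin d) → ℝ) : ℝ≥0∞ :=
  ∫⁻ x in Ω, ENNReal.ofReal
    ((∑ α, ∑ i, F α i x ^ 2) * Metric.infDist x (frontier Ω) ^ σ)

/-! Let δ be the distance to the boundary. The estimate is the energy estimate for the test function
`δ^σ u`. Differentiating the weight produces an error of size `|σ| δ^(σ-1) |u|`, which Hardy's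
inequality for `δ^(σ/2) u` controls by `|σ|` times the weighted energy of `∇u`. For small `|σ|`
ellipticity absorbs it. How small `|σ|` must be depends only on the Hardy constant, the ellipticity
and the dimensions.

Hardy's inequality (`exists_hardy_const`) is one-dimensional near the boundary. There Ω lies above a
Lipschitz graph, the height `t` above the graph has derivative 1 in the vertical direction, and `t ≤
(1 + M) δ`. Integrating `t⁻¹` by parts against `φ²` bounds `φ/t`, hence `φ/δ`. Away from the
boundary Poincaré's inequality suffices. The number of charts comes from a net of the unit ball
rescaled to the diameter, so the constant is uniform in Ω.

Since δ is not smooth and `δ^σ` may be singular, the energy estimate is run with a smooth `ζ ≥ δ`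
that is positive everywhere and has partial derivatives at most 1. On bounded Ω all integrals are
then finite, so absorption is legitimate, and `1/ζ ≤ 1/δ` lets the same Hardy constant serve every ζ
(`IsWeakSolution.smooth_weighted_estimate`). Finally ζ decreases to within any `ε` of δ, with
Fatou's lemma on the left (`weightedEnergy_le_of_forall_smooth`). -/

lemma integrable_mul_of_continuousAt_tsupport {E : Type*} [TopologicalSpace E] [MeasurableSpace E]
    [OpensMeasurableSpace E] {ν : Measure E} [IsFiniteMeasureOnCompacts ν] {a b : E → ℝ}
    (ha : ∀ x ∈ tsupport b, ContinuousAt a x) (hb : Continuous b) (hc : HasCompactSupport b) :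
    Integrable (fun x => a x * b x) ν := by
  refine Continuous.integrable_of_hasCompactSupport ?_ hc.mul_left
  refine continuous_of_tsupport fun x hx => ?_
  exact (ha x (tsupport_mul_subset_right hx)).mul hb.continuousAt

lemma integrable_fderiv_apply_sq {E : Type*} [NormedAddCommGroup E] [NormedSpace ℝ E]
    [MeasurableSpace E] [BorelSpace E] {ν : Measure E} [IsFiniteMeasureOnCompacts ν] {θ : E → ℝ}
    (hθ : ContDiff ℝ ∞ θ) (hc : HasCompactSupport θ) (e : E) :
    Integrable (fun x => fderiv ℝ θ x e ^ 2) ν := by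
  have hcd : Continuous fun x => fderiv ℝ θ x e :=
    (hθ.continuous_fderiv (by simp)).clm_apply continuous_const
  refine (hcd.pow 2).integrable_of_hasCompactSupport ?_
  simp only [pow_two]
  exact (hc.fderiv_apply ℝ e).mul_left

/-! ### One-dimensional Hardy and Poincaré inequalities by integration by parts. -/

section OneDirection

variable {E : Type*} [NormedAddCommGroup E] [NormedSpace ℝ E] [MeasurableSpace E] [BorelSpace E]
  [FiniteDimensional ℝ E] {ν : Measure E} [ν.IsAddHaarMeasure]

/-- Integration by parts in one direction against a coefficient `a` that need only be
differentiable in that direction, on the support of `θ`. -/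
lemma integral_mul_sq_eq_of_hasLineDerivAt {a a' θ : E → ℝ} {e : E}
    (hθ : ContDiff ℝ ∞ θ) (hc : HasCompactSupport θ)
    (ha : ∀ x ∈ tsupport θ, ContinuousAt a x) (ha' : ∀ x ∈ tsupport θ, ContinuousAt a' x)
    (hd : ∀ x ∈ tsupport θ, HasLineDerivAt ℝ a (a' x) x e) :
    Integrable (fun x => a' x * θ x ^ 2) ν ∧
      Integrable (fun x => a x * (2 * θ x * fderiv ℝ θ x e)) ν ∧
      ∫ x, a x * (2 * θ x * fderiv ℝ θ x e) ∂ν = -∫ x, a' x * θ x ^ 2 ∂ν := by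
  have hsq : tsupport (fun x => θ x ^ 2) ⊆ tsupport θ := by
    simp only [pow_two]; exact tsupport_mul_subset_left
  have hder : tsupport (fun x => 2 * θ x * fderiv ℝ θ x e) ⊆ tsupport θ := by
    refine (tsupport_mul_subset_left (f := fun x => 2 * θ x)).trans ?_
    exact tsupport_mul_subset_right (f := fun _ => (2 : ℝ))
  have hcd : Continuous fun x => fderiv ℝ θ x e :=
    (hθ.continuous_fderiv (by simp)).clm_apply continuous_const
  have c1 : HasCompactSupport (fun x => θ x ^ 2) := by
    simp only [pow_two]; exact hc.mul_left
  have c2 : HasCompactSupport (fun x => 2 * θ x * fderiv ℝ θ x e) :=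
    (hc.mul_left (f := fun _ => (2 : ℝ))).mul_right
  have i1 : Integrable (fun x => a' x * θ x ^ 2) ν :=
    integrable_mul_of_continuousAt_tsupport (fun x hx => ha' x (hsq hx))
      (hθ.continuous.pow 2) c1
  have i2 : Integrable (fun x => a x * (2 * θ x * fderiv ℝ θ x e)) ν :=
    integrable_mul_of_continuousAt_tsupport (fun x hx => ha x (hder hx))
      ((continuous_const.mul hθ.continuous).mul hcd) c2
  have i3 : Integrable (fun x => a x * θ x ^ 2) ν :=
    integrable_mul_of_continuousAt_tsupport (fun x hx => ha x (hsq hx))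
      (hθ.continuous.pow 2) c1
  refine ⟨i1, i2, ?_⟩
  refine integral_bilinear_hasLineDerivAt_right_eq_neg_left_of_integrable
    (B := ContinuousLinearMap.mul ℝ ℝ) (v := e) i1 i2 i3 (fun x hx => hd x (hsq hx)) ?_
  intro x _
  have h := (((hθ.differentiable (by simp)) x).hasFDerivAt.pow 2).hasLineDerivAt e
  convert h using 1
  simp

/-- **Hardy's inequality** in the direction `e`, for the height function `t` of a graph. -/
lemma integral_inv_sq_mul_sq_le {t θ : E → ℝ} {e : E} (ht : Continuous t)
    (hte : ∀ x (s : ℝ), t (x + s • e) = t x + s) (hθ : ContDiff ℝ ∞ θ) (hc : HasCompactSupport θ)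
    (hpos : ∀ x ∈ tsupport θ, 0 < t x) :
    Integrable (fun x => (t x)⁻¹ ^ 2 * θ x ^ 2) ν ∧
    ∫ x, (t x)⁻¹ ^ 2 * θ x ^ 2 ∂ν ≤ 4 * ∫ x, fderiv ℝ θ x e ^ 2 ∂ν := by
  have hinv : ∀ x ∈ tsupport θ, ContinuousAt (fun x => (t x)⁻¹) x := fun x hx =>
    ht.continuousAt.inv₀ (hpos x hx).ne'
  obtain ⟨i1, i2, h⟩ := integral_mul_sq_eq_of_hasLineDerivAt (ν := ν) (e := e)
    (a := fun x => (t x)⁻¹) (a' := fun x => -((t x)⁻¹ ^ 2)) hθ hc hinv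
    (fun x hx => ((hinv x hx).pow 2).neg) (by
      intro x hx
      have h1 : HasDerivAt (fun s : ℝ => t x + s) 1 0 := (hasDerivAt_id _).const_add _
      have h2 := h1.inv (by simpa using (hpos x hx).ne')
      unfold HasLineDerivAt
      simp only [hte]
      refine h2.congr_deriv ?_
      rw [add_zero, inv_pow, neg_div, one_div])
  have i1' : Integrable (fun x => (t x)⁻¹ ^ 2 * θ x ^ 2) ν := by simpa using i1.neg
  have i3 : Integrable (fun x => fderiv ℝ θ x e ^ 2) ν :=
    integrable_fderiv_apply_sq hθ hc e
  refine ⟨i1', ?_⟩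
  -- Young's inequality, balanced so that exactly half of the Hardy integral is absorbed. This gives
  -- the constant 4.
  have hle : ∫ x, (t x)⁻¹ * (2 * θ x * fderiv ℝ θ x e) ∂ν ≤
      ∫ x, ((1 / 2) * ((t x)⁻¹ ^ 2 * θ x ^ 2) + 2 * fderiv ℝ θ x e ^ 2) ∂ν := by
    refine integral_mono i2 ((i1'.const_mul _).add (i3.const_mul _)) fun x => ?_
    simp only []
    nlinarith [sq_nonneg ((t x)⁻¹ * θ x - 2 * fderiv ℝ θ x e)]
  rw [integral_add (i1'.const_mul _) (i3.const_mul _), integral_const_mul, integral_const_mul, h]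
    at hle
  simp only [neg_mul, integral_neg, neg_neg] at hle
  linarith

/-- **Poincaré's inequality** for functions supported between two hyperplanes. -/
lemma integral_sq_le_of_abs_le {ℓ : E →L[ℝ] ℝ} {c D : ℝ} {θ : E → ℝ} {e : E} (he : ℓ e = 1)
    (hθ : ContDiff ℝ ∞ θ) (hc : HasCompactSupport θ)
    (hD : ∀ x ∈ tsupport θ, |ℓ x - c| ≤ D) :
    ∫ x, θ x ^ 2 ∂ν ≤ 4 * D ^ 2 * ∫ x, fderiv ℝ θ x e ^ 2 ∂ν := by
  have ht : Continuous fun x => ℓ x - c := by fun_prop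
  obtain ⟨i1, i2, h⟩ := integral_mul_sq_eq_of_hasLineDerivAt (ν := ν) (e := e)
    (a := fun x => ℓ x - c) (a' := fun _ => 1) hθ hc (fun x _ => ht.continuousAt)
    (fun x _ => continuousAt_const) (by
      intro x _
      have h := (ℓ.hasFDerivAt (x := x)).hasLineDerivAt e
      rw [he] at h
      exact HasDerivAt.sub_const c h)
  have i3 : Integrable (fun x => fderiv ℝ θ x e ^ 2) ν :=
    integrable_fderiv_apply_sq hθ hc e
  simp only [one_mul] at i1 h
  -- The same absorption, with the coefficient `ℓ - c`, of derivative 1 along `e`, in place of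
  -- `t⁻¹`.
  have hle : ∫ x, -((ℓ x - c) * (2 * θ x * fderiv ℝ θ x e)) ∂ν ≤
      ∫ x, ((1 / 2) * θ x ^ 2 + 2 * D ^ 2 * fderiv ℝ θ x e ^ 2) ∂ν := by
    refine integral_mono i2.neg ((i1.const_mul _).add (i3.const_mul _)) fun x => ?_
    simp only []
    by_cases hx : x ∈ tsupport θ
    · have h2 : (ℓ x - c) ^ 2 ≤ D ^ 2 := sq_le_sq.2 ((hD x hx).trans (le_abs_self D))
      nlinarith [sq_nonneg (θ x + 2 * (ℓ x - c) * fderiv ℝ θ x e), sq_nonneg (fderiv ℝ θ x e)]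
    · rw [image_eq_zero_of_notMem_tsupport hx]
      simp only [mul_zero, zero_mul, neg_zero]
      positivity
  rw [integral_add (i1.const_mul _) (i3.const_mul _), integral_const_mul, integral_const_mul,
    integral_neg, h, neg_neg] at hle
  linarith

end OneDirection

/-! ### Hardy's inequality near one boundary point. -/

section HardyLipschitz

variable {d : ℕ}

lemma sq_fderiv_apply_le (φ : EuclideanSpace ℝ (Fin d) → ℝ) (x e : EuclideanSpace ℝ (Fin d))
    (he : ‖e‖ = 1) : fderiv ℝ φ x e ^ 2 ≤ ∑ i, partialDeriv i φ x ^ 2 := by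
  have h1 : fderiv ℝ φ x e = ∑ i, e i * partialDeriv i φ x := by
    have h2 : e = ∑ i, e i • EuclideanSpace.single i (1 : ℝ) := by
      have := (EuclideanSpace.basisFun (Fin d) ℝ).sum_repr e
      simpa using this.symm
    conv_lhs => rw [h2, map_sum]
    simp [partialDeriv]
  have h3 : ∑ i, e i ^ 2 = 1 := by
    rw [← EuclideanSpace.real_norm_sq_eq, he, one_pow]
  rw [h1]
  calc _ ≤ (∑ i, e i ^ 2) * ∑ i, partialDeriv i φ x ^ 2 := Finset.sum_mul_sq_le_sq_mul_sq _ _ _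
    _ = _ := by rw [h3, one_mul]

section Height

variable {e : EuclideanSpace ℝ (Fin d)} {ψ : (ℝ ∙ e)ᗮ → ℝ} {M : ℝ≥0}

/-- The height of a point above the graph of `ψ` in the direction `e`. -/
noncomputable def graphHeight (e : EuclideanSpace ℝ (Fin d)) (ψ : (ℝ ∙ e)ᗮ → ℝ)
    (x : EuclideanSpace ℝ (Fin d)) : ℝ :=
  inner ℝ e x - ψ ((ℝ ∙ e)ᗮ.orthogonalProjectionOnto x)

lemma continuous_graphHeight (hψ : LipschitzWith M ψ) : Continuous (graphHeight e ψ) := by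
  unfold graphHeight
  have := hψ.continuous
  fun_prop

lemma graphHeight_add_smul (he : ‖e‖ = 1) (x : EuclideanSpace ℝ (Fin d)) (s : ℝ) :
    graphHeight e ψ (x + s • e) = graphHeight e ψ x + s := by
  simp only [graphHeight, map_add, map_smul, inner_add_right, inner_smul_right,
    Submodule.orthogonalProjectionOnto_orthogonalComplement_singleton_eq_zero,
    real_inner_self_eq_norm_sq, he, smul_zero, add_zero]
  ring

/-- The coordinate along `e` contributes 1 to the Lipschitz constant and `ψ` after the projection, a
contraction, contributes `M`. Applied with `y` on the boundary, this compares height with distance.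
-/
lemma graphHeight_sub_le (he : ‖e‖ = 1) (hψ : LipschitzWith M ψ)
    (x y : EuclideanSpace ℝ (Fin d)) :
    graphHeight e ψ x - graphHeight e ψ y ≤ (1 + M) * dist x y := by
  have h1 : inner ℝ e x - inner ℝ e y ≤ dist x y := by
    rw [← inner_sub_right, dist_eq_norm]
    simpa [he] using real_inner_le_norm e (x - y)
  have h2 := hψ.dist_le_mul ((ℝ ∙ e)ᗮ.orthogonalProjectionOnto y)
    ((ℝ ∙ e)ᗮ.orthogonalProjectionOnto x)
  have h3 : dist ((ℝ ∙ e)ᗮ.orthogonalProjectionOnto y)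
      ((ℝ ∙ e)ᗮ.orthogonalProjectionOnto x) ≤ dist x y := by
    rw [dist_comm x y, dist_eq_norm, dist_eq_norm, ← map_sub]
    exact Submodule.norm_orthogonalProjectionOnto_apply_le _ _
  have h4 := (le_abs_self _).trans ((Real.dist_eq _ _).symm.le.trans
    (h2.trans (mul_le_mul_of_nonneg_left h3 M.coe_nonneg)))
  simp only [graphHeight]
  linarith

end Height

lemma IsTestFunction.mul_left {Ω : Set (EuclideanSpace ℝ (Fin d))}
    {η φ : EuclideanSpace ℝ (Fin d) → ℝ} (hη : ContDiff ℝ ∞ η) (hφ : IsTestFunction Ω φ) :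
    IsTestFunction Ω (fun x => η x * φ x) :=
  ⟨hη.mul hφ.contDiff, hφ.hasCompactSupport.mul_left,
    tsupport_mul_subset_right.trans hφ.tsupport_subset⟩

lemma partialDeriv_mul {η φ : EuclideanSpace ℝ (Fin d) → ℝ} (hη : ContDiff ℝ ∞ η)
    (hφ : ContDiff ℝ ∞ φ) (i : Fin d) (x : EuclideanSpace ℝ (Fin d)) :
    partialDeriv i (fun x => η x * φ x) x = η x * partialDeriv i φ x + φ x * partialDeriv i η x := by
  unfold partialDeriv
  rw [fderiv_fun_mul (hη.differentiable (by simp) x) (hφ.differentiable (by simp) x)]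
  simp

lemma IsTestFunction.eq_zero {Ω : Set (EuclideanSpace ℝ (Fin d))}
    {φ : EuclideanSpace ℝ (Fin d) → ℝ} (hφ : IsTestFunction Ω φ) {x : EuclideanSpace ℝ (Fin d)}
    (hx : x ∉ Ω) : φ x = 0 :=
  image_eq_zero_of_notMem_tsupport fun h => hx (hφ.tsupport_subset h)

lemma IsTestFunction.partialDeriv_eq_zero {Ω : Set (EuclideanSpace ℝ (Fin d))}
    {φ : EuclideanSpace ℝ (Fin d) → ℝ} (hφ : IsTestFunction Ω φ) {x : EuclideanSpace ℝ (Fin d)}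
    (hx : x ∉ Ω) (i : Fin d) : partialDeriv i φ x = 0 := by
  have h : x ∉ tsupport (fderiv ℝ φ) := fun h =>
    hx (hφ.tsupport_subset (tsupport_fderiv_subset ℝ h))
  simp [partialDeriv, image_eq_zero_of_notMem_tsupport h]

/-- The part of Hardy's inequality near a boundary point, in terms of a majorant `q`
of `φ² / dist(·, ∂Ω)²`. -/
lemma exists_local_hardy_majorant {M : ℝ≥0} {c₀ : ℝ} {Ω : Set (EuclideanSpace ℝ (Fin d))}
    (hΩ : IsBoundedLipschitz M c₀ Ω) {χ : ContDiffBump (0 : EuclideanSpace ℝ (Fin d))}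
    (hin : χ.rIn = 1) (hout : χ.rOut = 2) {L : ℝ} (hL : ∀ x, ‖fderiv ℝ χ x‖ ≤ L)
    {ρ : ℝ} (hρ : 0 < ρ) (hρD : 4 * ρ = c₀ * Metric.diam Ω)
    {x₀ : EuclideanSpace ℝ (Fin d)} (hx₀ : x₀ ∈ frontier Ω)
    {φ : EuclideanSpace ℝ (Fin d) → ℝ} (hφ : IsTestFunction Ω φ) :
    ∃ q : EuclideanSpace ℝ (Fin d) → ℝ, Integrable q ∧ (∀ x, 0 ≤ q x) ∧
      (∀ x ∈ Ω, dist x x₀ ≤ ρ → φ x ^ 2 ≤ Metric.infDist x (frontier Ω) ^ 2 * q x) ∧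
      ∫ x, q x ≤ 8 * (1 + M) ^ 2 *
        ((∫ x, ∑ i, partialDeriv i φ x ^ 2) + (L / ρ) ^ 2 * ∫ x, φ x ^ 2) := by
  obtain ⟨e, ψ, he, hψ, hgraph⟩ := hΩ.exists_graph x₀ hx₀
  rw [← hρD] at hgraph
  have hmem : ∀ x, dist x x₀ < 4 * ρ → (x ∈ Ω ↔ 0 < graphHeight e ψ x) := by
    intro x hx
    have h := Set.ext_iff.1 hgraph x
    simp only [Set.mem_inter_iff, Metric.mem_ball, hx, and_true, Set.mem_ofPred_eq] at h
    rw [h, graphHeight, sub_pos]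
  -- A cutoff equal to 1 on the ball of radius `ρ` and supported in radius `2ρ`, inside the chart of
  -- radius `4ρ`. Its derivative is at most `L / ρ`, with `L` independent of Ω.
  set η : EuclideanSpace ℝ (Fin d) → ℝ := fun x => χ (ρ⁻¹ • (x - x₀)) with hη_def
  have hη : ContDiff ℝ ∞ η := χ.contDiff.comp (by fun_prop)
  have hη1 : ∀ x, dist x x₀ ≤ ρ → η x = 1 := by
    intro x hx
    refine χ.one_of_mem_closedBall ?_
    rw [mem_closedBall_zero_iff, norm_smul, norm_inv, Real.norm_of_nonneg hρ.le, ← dist_eq_norm,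
      hin, inv_mul_le_iff₀ hρ, mul_one]
    exact hx
  have hη0 : tsupport η ⊆ Metric.closedBall x₀ (2 * ρ) := by
    refine closure_minimal (fun x hx => ?_) Metric.isClosed_closedBall
    have : ρ⁻¹ • (x - x₀) ∈ Function.support χ := hx
    rw [χ.support_eq, mem_ball_zero_iff, norm_smul, norm_inv, Real.norm_of_nonneg hρ.le,
      ← dist_eq_norm, hout, inv_mul_lt_iff₀ hρ, mul_comm] at this
    exact this.le
  have hη' : ∀ x, fderiv ℝ η x e ^ 2 ≤ (L / ρ) ^ 2 := by
    intro x
    have h1 : HasFDerivAt (fun x => ρ⁻¹ • (x - x₀))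
        (ρ⁻¹ • ContinuousLinearMap.id ℝ (EuclideanSpace ℝ (Fin d))) x :=
      ((hasFDerivAt_id x).sub_const x₀).const_smul ρ⁻¹
    have h2 : HasFDerivAt χ (fderiv ℝ χ (ρ⁻¹ • (x - x₀))) (ρ⁻¹ • (x - x₀)) :=
      ((χ.contDiff (n := 1)).differentiable (by simp) _).hasFDerivAt
    have h3 : fderiv ℝ η x e = ρ⁻¹ * fderiv ℝ χ (ρ⁻¹ • (x - x₀)) e := by
      have h := h2.comp x h1
      change HasFDerivAt η _ x at h
      rw [h.fderiv]; simp
    have h4 : |fderiv ℝ χ (ρ⁻¹ • (x - x₀)) e| ≤ L := by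
      have := (fderiv ℝ χ (ρ⁻¹ • (x - x₀))).le_opNorm e
      rw [he, mul_one] at this
      exact this.trans (hL _)
    rw [h3, div_eq_inv_mul, mul_pow, mul_pow]
    exact mul_le_mul_of_nonneg_left (sq_le_sq.2 (h4.trans (le_abs_self L))) (sq_nonneg _)
  have hθ : IsTestFunction Ω (fun x => η x * φ x) := hφ.mul_left hη
  have hpos : ∀ x ∈ tsupport (fun x => η x * φ x), 0 < graphHeight e ψ x := by
    intro x hx
    have h1 := hη0 (tsupport_mul_subset_left hx)
    rw [Metric.mem_closedBall] at h1
    exact (hmem x (by linarith)).1 (hθ.tsupport_subset hx)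
  obtain ⟨hint, hle⟩ := integral_inv_sq_mul_sq_le (ν := volume) (continuous_graphHeight hψ)
    (graphHeight_add_smul he) hθ.contDiff hθ.hasCompactSupport hpos
  have hI1 : Integrable (fun x => ∑ i, partialDeriv i φ x ^ 2) :=
    integrable_finsetSum _ fun i _ =>
      integrable_fderiv_apply_sq hφ.contDiff hφ.hasCompactSupport _
  have hI2 : Integrable (fun x => φ x ^ 2) := by
    refine (hφ.contDiff.continuous.pow 2).integrable_of_hasCompactSupport ?_
    simp only [pow_two]
    exact hφ.hasCompactSupport.mul_left
  refine ⟨fun x => (1 + M) ^ 2 * ((graphHeight e ψ x)⁻¹ ^ 2 * (η x * φ x) ^ 2),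
    hint.const_mul _, fun x => by positivity, fun x hx hxρ => ?_, ?_⟩
  · beta_reduce
    rw [hη1 x hxρ, one_mul]
    have htpos : 0 < graphHeight e ψ x := (hmem x (by linarith)).1 hx
    obtain ⟨y, hy, hxy⟩ := isClosed_frontier.exists_infDist_eq_dist ⟨x₀, hx₀⟩ x
    have hyρ : dist x y ≤ ρ := by
      rw [← hxy]; exact (Metric.infDist_le_dist_of_mem hx₀).trans hxρ
    -- The nearest boundary point `y` is within `2ρ` of `x₀`, so the chart still describes Ω at `y`.
    -- As Ω is open, `y ∉ Ω`.
    have hyt : graphHeight e ψ y ≤ 0 := by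
      by_contra! hcon
      have h1 : dist y x₀ ≤ dist x y + dist x x₀ := by
        rw [dist_comm x y]; exact dist_triangle _ _ _
      have h2 := (hmem y (by linarith)).2 hcon
      rw [hΩ.isOpen.frontier_eq] at hy
      exact hy.2 h2
    have ht : graphHeight e ψ x ≤ (1 + M) * Metric.infDist x (frontier Ω) := by
      have := graphHeight_sub_le he hψ x y
      rw [hxy]; linarith
    have h2 : graphHeight e ψ x ^ 2 ≤ ((1 + M) * Metric.infDist x (frontier Ω)) ^ 2 :=
      pow_le_pow_left₀ htpos.le ht 2
    calc φ x ^ 2 = graphHeight e ψ x ^ 2 * ((graphHeight e ψ x)⁻¹ ^ 2 * φ x ^ 2) := by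
          field_simp
      _ ≤ ((1 + M) * Metric.infDist x (frontier Ω)) ^ 2 *
          ((graphHeight e ψ x)⁻¹ ^ 2 * φ x ^ 2) := by gcongr
      _ = _ := by ring
  · rw [integral_const_mul]
    have h3 : ∫ x, fderiv ℝ (fun x => η x * φ x) x e ^ 2 ≤
        ∫ x, (2 * ∑ i, partialDeriv i φ x ^ 2 + 2 * (L / ρ) ^ 2 * φ x ^ 2) := by
      refine integral_mono (integrable_fderiv_apply_sq hθ.contDiff hθ.hasCompactSupport e)
        ((hI1.const_mul _).add (hI2.const_mul _)) fun x => ?_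
      simp only []
      rw [fderiv_fun_mul (hη.differentiable (by simp) x) (hφ.contDiff.differentiable (by simp) x)]
      simp only [add_apply, smul_apply, smul_eq_mul]
      have h4 := sq_fderiv_apply_le φ x e he
      have h5 : (η x * fderiv ℝ φ x e) ^ 2 ≤ fderiv ℝ φ x e ^ 2 := by
        rw [mul_pow]
        exact mul_le_of_le_one_left (sq_nonneg _) (pow_le_one₀ χ.nonneg χ.le_one)
      have h6 : (φ x * fderiv ℝ η x e) ^ 2 ≤ φ x ^ 2 * (L / ρ) ^ 2 := by
        rw [mul_pow]
        exact mul_le_mul_of_nonneg_left (hη' x) (sq_nonneg _)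
      nlinarith [sq_nonneg (η x * fderiv ℝ φ x e - φ x * fderiv ℝ η x e)]
    rw [integral_add (hI1.const_mul _) (hI2.const_mul _), integral_const_mul,
      integral_const_mul] at h3
    calc _ ≤ (1 + M : ℝ) ^ 2 * (4 * (2 * (∫ x, ∑ i, partialDeriv i φ x ^ 2) +
          2 * (L / ρ) ^ 2 * ∫ x, φ x ^ 2)) := by
          refine mul_le_mul_of_nonneg_left (hle.trans ?_) (by positivity)
          exact mul_le_mul_of_nonneg_left h3 (by norm_num)
      _ = _ := by ring

end HardyLipschitz

/-! ### Hardy's inequality on the whole domain. -/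

section HardyGlobal

variable {d : ℕ}

lemma IsTestFunction.sum_setIntegral_partialDeriv_sq_eq {Ω : Set (EuclideanSpace ℝ (Fin d))}
    {φ : EuclideanSpace ℝ (Fin d) → ℝ} (hφ : IsTestFunction Ω φ) :
    ∑ i, ∫ x in Ω, partialDeriv i φ x ^ 2 = ∫ x, ∑ i, partialDeriv i φ x ^ 2 := by
  have hint : ∀ i ∈ Finset.univ, Integrable (fun x => partialDeriv i φ x ^ 2) := fun i _ =>
    integrable_fderiv_apply_sq hφ.contDiff hφ.hasCompactSupport _
  rw [integral_finsetSum _ hint]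
  exact Finset.sum_congr rfl fun i _ => setIntegral_eq_integral_of_forall_compl_eq_zero
    fun x hx => by simp [hφ.partialDeriv_eq_zero hx]

lemma IsTestFunction.integral_sq_le (hd : 0 < d) {Ω : Set (EuclideanSpace ℝ (Fin d))}
    (hΩ : Bornology.IsBounded Ω) {φ : EuclideanSpace ℝ (Fin d) → ℝ} (hφ : IsTestFunction Ω φ) :
    ∫ x, φ x ^ 2 ≤ 4 * Metric.diam Ω ^ 2 * ∫ x, ∑ i, partialDeriv i φ x ^ 2 := by
  rcases Ω.eq_empty_or_nonempty with rfl | ⟨a, ha⟩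
  · have h0 : ∀ x, φ x = 0 := fun x => hφ.eq_zero (Set.notMem_empty x)
    simp [h0]
  let i : Fin d := ⟨0, hd⟩
  refine (integral_sq_le_of_abs_le (ν := volume) (ℓ := EuclideanSpace.proj i) (c := a i)
    (D := Metric.diam Ω) (e := EuclideanSpace.single i 1) (by simp) hφ.contDiff
    hφ.hasCompactSupport fun x hx => ?_).trans ?_
  · have h1 := PiLp.norm_apply_le (x - a) i
    rw [← dist_eq_norm] at h1
    exact h1.trans (Metric.dist_le_diam_of_mem hΩ (hφ.tsupport_subset hx) ha)
  · refine mul_le_mul_of_nonneg_left ?_ (by positivity)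
    refine integral_mono (integrable_fderiv_apply_sq hφ.contDiff hφ.hasCompactSupport _)
      (integrable_finsetSum _ fun i _ =>
        integrable_fderiv_apply_sq hφ.contDiff hφ.hasCompactSupport _) fun x => ?_
    exact Finset.single_le_sum (f := fun i => partialDeriv i φ x ^ 2)
      (fun i _ => sq_nonneg _) (Finset.mem_univ i)

lemma frontier_nonempty_of_isBounded (hd : 0 < d) {Ω : Set (EuclideanSpace ℝ (Fin d))}
    (hΩ : Bornology.IsBounded Ω) (hne : Ω.Nonempty) : (frontier Ω).Nonempty := by
  have : Nonempty (Fin d) := ⟨⟨0, hd⟩⟩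
  refine nonempty_frontier_iff.2 ⟨hne, ?_⟩
  rintro rfl
  exact NormedSpace.unbounded_univ ℝ (EuclideanSpace ℝ (Fin d)) hΩ

lemma diam_pos_of_isOpen (hd : 0 < d) {Ω : Set (EuclideanSpace ℝ (Fin d))}
    (hΩ : Bornology.IsBounded Ω) (ho : IsOpen Ω) (hne : Ω.Nonempty) : 0 < Metric.diam Ω := by
  have : Nonempty (Fin d) := ⟨⟨0, hd⟩⟩
  obtain ⟨a, ha⟩ := hne
  obtain ⟨x, hx, y, hy, hxy⟩ :=
    Set.Infinite.nontrivial (infinite_of_mem_nhds (X := EuclideanSpace ℝ (Fin d)) a (ho.mem_nhds ha))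
  exact (dist_pos.2 hxy).trans_le (Metric.dist_le_diam_of_mem hΩ hx hy)

lemma infDist_frontier_pos (hd : 0 < d) {Ω : Set (EuclideanSpace ℝ (Fin d))}
    (hΩ : Bornology.IsBounded Ω) (ho : IsOpen Ω) {x : EuclideanSpace ℝ (Fin d)} (hx : x ∈ Ω) :
    0 < Metric.infDist x (frontier Ω) := by
  refine (isClosed_frontier.notMem_iff_infDist_pos
    (frontier_nonempty_of_isBounded hd hΩ ⟨x, hx⟩)).1 ?_
  rw [ho.frontier_eq]
  exact fun h => h.2 hx

/-- **Hardy's inequality** on Lipschitz domains, with a constant depending only on the dimension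
and the Lipschitz character; `b` stands for any function bounded by `1 / dist(·, ∂Ω)`. -/
theorem exists_hardy_const (hd : 0 < d) (M : ℝ≥0) (c₀ : ℝ) (hc₀ : 0 < c₀) :
    ∃ C : ℝ, 0 < C ∧ ∀ Ω : Set (EuclideanSpace ℝ (Fin d)), IsBoundedLipschitz M c₀ Ω →
      ∀ φ, IsTestFunction Ω φ → ∀ b : EuclideanSpace ℝ (Fin d) → ℝ,
        (∀ x ∈ Ω, |b x| * Metric.infDist x (frontier Ω) ≤ 1) →
        ∫ x in Ω, (b x * φ x) ^ 2 ≤ C * ∑ i, ∫ x in Ω, partialDeriv i φ x ^ 2 := by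
  let χ : ContDiffBump (0 : EuclideanSpace ℝ (Fin d)) := ⟨1, 2, by norm_num, by norm_num⟩
  obtain ⟨L, hL⟩ : ∃ L, ∀ x, ‖fderiv ℝ χ x‖ ≤ L :=
    ((χ.contDiff (n := 1)).continuous_fderiv (by simp)).bounded_above_of_compact_support
      (χ.hasCompactSupport.fderiv ℝ)
  -- A net chosen before Ω. Scaled by the diameter `D` and centred at a point of Ω, its balls have
  -- radius `c₀ D / 12 = ρ / 3` and cover the boundary, so the number of charts does not depend on
  -- Ω.
  obtain ⟨T, -, hTfin, hT⟩ := (isCompact_closedBall (0 : EuclideanSpace ℝ (Fin d)) 1).finite_cover_balls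
    (e := c₀ / 12) (by positivity)
  lift T to Finset (EuclideanSpace ℝ (Fin d)) using hTfin
  refine ⟨T.card * (8 * (1 + M) ^ 2 * (1 + 64 * L ^ 2 / c₀ ^ 2)) + 576 / c₀ ^ 2, by positivity, ?_⟩
  intro Ω hΩ φ hφ b hb
  rcases Ω.eq_empty_or_nonempty with rfl | hne
  · simp
  have hD := diam_pos_of_isOpen hd hΩ.isBounded hΩ.isOpen hne
  have hfr := frontier_nonempty_of_isBounded hd hΩ.isBounded hne
  set D := Metric.diam Ω with hDdef
  set δ : EuclideanSpace ℝ (Fin d) → ℝ := fun x => Metric.infDist x (frontier Ω) with hδ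
  have hδpos : ∀ x ∈ Ω, 0 < δ x := fun x hx => infDist_frontier_pos hd hΩ.isBounded hΩ.isOpen hx
  set ρ : ℝ := c₀ * D / 4 with hρ
  have hρpos : 0 < ρ := by positivity
  obtain ⟨a, ha⟩ := hne
  -- Charts must be centred on the boundary: a ball that meets it is recentred at a boundary point,
  -- at the cost of doubling the radius. For other balls any boundary point will do.
  have hnear : ∀ s : EuclideanSpace ℝ (Fin d), ∃ z ∈ frontier Ω,
      ∀ y ∈ frontier Ω, dist y (a + D • s) < ρ / 3 → dist y z < 2 * (ρ / 3) := by
    intro s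
    by_cases h : ∃ z ∈ frontier Ω, dist z (a + D • s) < ρ / 3
    · obtain ⟨z, hz, hzs⟩ := h
      refine ⟨z, hz, fun y _ hys => ?_⟩
      have := dist_triangle_right y z (a + D • s)
      linarith
    · obtain ⟨z, hz⟩ := hfr
      exact ⟨z, hz, fun y hy hys => absurd ⟨y, hy, hys⟩ h⟩
  choose z hz hzy using hnear
  have hloc := fun s => exists_local_hardy_majorant hΩ (χ := χ) rfl rfl hL hρpos
    (by rw [hρ]; ring) (hz s) hφ
  choose q hqi hq0 hqle hqint using hloc
  have hcover : ∀ x ∈ Ω, δ x < ρ / 3 → ∃ s ∈ T, dist x (z s) ≤ ρ := by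
    intro x hx hxδ
    obtain ⟨y, hy, hxy⟩ := (Metric.infDist_lt_iff hfr).1 hxδ
    have hya : dist y a ≤ D := by
      rw [hDdef, ← Metric.diam_closure]
      exact Metric.dist_le_diam_of_mem hΩ.isBounded.closure (frontier_subset_closure hy)
        (subset_closure ha)
    have hmem : D⁻¹ • (y - a) ∈ Metric.closedBall (0 : EuclideanSpace ℝ (Fin d)) 1 := by
      rw [mem_closedBall_zero_iff, norm_smul, norm_inv, Real.norm_of_nonneg hD.le,
        ← dist_eq_norm, inv_mul_le_iff₀ hD, mul_one]
      exact hya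
    obtain ⟨s, hs, hys⟩ := Set.mem_iUnion₂.1 (hT hmem)
    refine ⟨s, hs, ?_⟩
    have h1 : dist y (a + D • s) < ρ / 3 := by
      have h2 : y - (a + D • s) = D • (D⁻¹ • (y - a) - s) := by
        rw [smul_sub, smul_inv_smul₀ hD.ne']; abel
      rw [dist_eq_norm, h2, norm_smul, Real.norm_of_nonneg hD.le, ← dist_eq_norm]
      rw [Metric.mem_ball] at hys
      calc D * dist (D⁻¹ • (y - a)) s < D * (c₀ / 12) := by gcongr
        _ = ρ / 3 := by rw [hρ]; ring
    have h3 := hzy s y hy h1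
    have h4 := dist_triangle x y (z s)
    linarith
  have hI2 : Integrable (fun x => φ x ^ 2) := by
    refine (hφ.contDiff.continuous.pow 2).integrable_of_hasCompactSupport ?_
    simp only [pow_two]
    exact hφ.hasCompactSupport.mul_left
  have hsum : Integrable (fun x => ∑ s ∈ T, q s x) := integrable_finsetSum _ fun s _ => hqi s
  -- Where `δ < ρ / 3` a chart majorant dominates; elsewhere `|b| ≤ 3 / ρ`. Nonnegativity of the `q
  -- s` allows summing them without a partition of Ω.
  have hpt : ∀ x ∈ Ω, (b x * φ x) ^ 2 ≤ (9 / ρ ^ 2) * φ x ^ 2 + ∑ s ∈ T, q s x := by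
    intro x hx
    have hδx := hδpos x hx
    have hbx : b x ^ 2 * δ x ^ 2 ≤ 1 := by
      rw [← sq_abs (b x), ← mul_pow]
      exact pow_le_one₀ (mul_nonneg (abs_nonneg _) hδx.le) (hb x hx)
    have hs0 : 0 ≤ ∑ s ∈ T, q s x := Finset.sum_nonneg fun s _ => hq0 s x
    rw [mul_pow]
    by_cases hcase : δ x < ρ / 3
    · obtain ⟨s, hs, hxs⟩ := hcover x hx hcase
      have h1 := hqle s x hx hxs
      have h2 : q s x ≤ ∑ s ∈ T, q s x :=
        Finset.single_le_sum (f := fun s => q s x) (fun s _ => hq0 s x) hs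
      have h3 : b x ^ 2 * φ x ^ 2 ≤ b x ^ 2 * (δ x ^ 2 * q s x) := by gcongr
      have h4 : b x ^ 2 * δ x ^ 2 * q s x ≤ 1 * q s x := by gcongr; exact hq0 s x
      have h5 : 0 ≤ (9 / ρ ^ 2) * φ x ^ 2 := by positivity
      linarith
    · have h1 : (ρ / 3) ^ 2 ≤ δ x ^ 2 := by
        refine pow_le_pow_left₀ (by positivity) (not_lt.1 hcase) 2
      have h2 : b x ^ 2 ≤ 9 / ρ ^ 2 := by
        rw [le_div_iff₀ (by positivity)]
        nlinarith [sq_nonneg (b x), mul_le_mul_of_nonneg_left h1 (sq_nonneg (b x))]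
      have h3 : b x ^ 2 * φ x ^ 2 ≤ 9 / ρ ^ 2 * φ x ^ 2 := by gcongr
      linarith
  have hle : ∫ x in Ω, (b x * φ x) ^ 2 ≤ ∫ x in Ω, ((9 / ρ ^ 2) * φ x ^ 2 + ∑ s ∈ T, q s x) := by
    refine integral_mono_of_nonneg (ae_of_all _ fun x => sq_nonneg _)
      ((hI2.const_mul _).add hsum).integrableOn ?_
    filter_upwards [ae_restrict_mem hΩ.isOpen.measurableSet] with x hx using hpt x hx
  have hle2 : ∫ x in Ω, ((9 / ρ ^ 2) * φ x ^ 2 + ∑ s ∈ T, q s x) ≤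
      ∫ x, ((9 / ρ ^ 2) * φ x ^ 2 + ∑ s ∈ T, q s x) := by
    refine setIntegral_le_integral ((hI2.const_mul _).add hsum) (ae_of_all _ fun x => ?_)
    exact add_nonneg (by positivity) (Finset.sum_nonneg fun s _ => hq0 s x)
  rw [integral_add (hI2.const_mul _) hsum, integral_const_mul,
    integral_finsetSum _ fun s _ => hqi s] at hle2
  rw [hφ.sum_setIntegral_partialDeriv_sq_eq]
  have hP := hφ.integral_sq_le hd hΩ.isBounded
  rw [← hDdef] at hP
  set I := ∫ x, ∑ i, partialDeriv i φ x ^ 2 with hI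
  set J := ∫ x, φ x ^ 2 with hJ
  -- Since `ρ = c₀ D / 4`, the factor `D ^ 2` from Poincaré's inequality cancels and the constants
  -- are scale invariant.
  have hLJ : (L / ρ) ^ 2 * J ≤ 64 * L ^ 2 / c₀ ^ 2 * I := by
    calc (L / ρ) ^ 2 * J ≤ (L / ρ) ^ 2 * (4 * D ^ 2 * I) := by gcongr
      _ = _ := by rw [hρ]; field_simp; ring
  have hJ2 : 9 / ρ ^ 2 * J ≤ 576 / c₀ ^ 2 * I := by
    calc 9 / ρ ^ 2 * J ≤ 9 / ρ ^ 2 * (4 * D ^ 2 * I) := by gcongr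
      _ = _ := by rw [hρ]; field_simp; ring
  have hS : ∑ s ∈ T, ∫ x, q s x ≤
      T.card * (8 * (1 + M) ^ 2 * (I + 64 * L ^ 2 / c₀ ^ 2 * I)) := by
    rw [← nsmul_eq_mul]
    refine Finset.sum_le_card_nsmul _ _ _ fun s _ => (hqint s).trans ?_
    gcongr
  calc _ ≤ _ := hle.trans hle2
    _ ≤ 576 / c₀ ^ 2 * I + T.card * (8 * (1 + M) ^ 2 * (I + 64 * L ^ 2 / c₀ ^ 2 * I)) := by
      gcongr
    _ = _ := by ring

end HardyGlobal

/-! ### Convergence in L² and its products. -/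

section TendstoL2

variable {X : Type*} [MeasurableSpace X] {ν : Measure X}

/-- Convergence in `L²(ν)` of a sequence of real-valued functions. -/
structure TendstoL2 (ν : Measure X) (f : ℕ → X → ℝ) (g : X → ℝ) : Prop where
  memLp_seq : ∀ n, MemLp (f n) 2 ν
  memLp : MemLp g 2 ν
  tendsto : Filter.Tendsto (fun n => eLpNorm (f n - g) 2 ν) Filter.atTop (nhds 0)

lemma TendstoL2.const {g : X → ℝ} (hg : MemLp g 2 ν) : TendstoL2 ν (fun _ => g) g :=
  ⟨fun _ => hg, hg, by simp⟩

lemma TendstoL2.add {f f' : ℕ → X → ℝ} {g g' : X → ℝ} (h : TendstoL2 ν f g)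
    (h' : TendstoL2 ν f' g') :
    TendstoL2 ν (fun n x => f n x + f' n x) (fun x => g x + g' x) := by
  refine ⟨fun n => (h.memLp_seq n).add (h'.memLp_seq n), h.memLp.add h'.memLp, ?_⟩
  have h0 := h.tendsto.add h'.tendsto
  rw [add_zero] at h0
  refine tendsto_of_tendsto_of_tendsto_of_le_of_le tendsto_const_nhds h0 (fun _ => zero_le)
    fun n => ?_
  have e : (fun x => f n x + f' n x) - (fun x => g x + g' x) = (f n - g) + (f' n - g') := by
    ext x; simp only [Pi.sub_apply, Pi.add_apply]; ring
  rw [e]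
  exact eLpNorm_add_le ((h.memLp_seq n).sub h.memLp).1 ((h'.memLp_seq n).sub h'.memLp).1
    (by norm_num)

lemma MeasureTheory.MemLp.bounded_mul {b g : X → ℝ} {K : ℝ} (hg : MemLp g 2 ν)
    (hb : AEStronglyMeasurable b ν) (hK : ∀ᵐ x ∂ν, |b x| ≤ K) :
    MemLp (fun x => b x * g x) 2 ν := by
  refine hg.of_le_mul (c := K) (hb.mul hg.1) ?_
  filter_upwards [hK] with x hx
  rw [norm_mul, Real.norm_eq_abs]
  gcongr

lemma TendstoL2.bounded_mul {f : ℕ → X → ℝ} {b g : X → ℝ} {K : ℝ} (h : TendstoL2 ν f g)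
    (hb : AEStronglyMeasurable b ν) (hK : ∀ᵐ x ∂ν, |b x| ≤ K) :
    TendstoL2 ν (fun n x => b x * f n x) (fun x => b x * g x) := by
  refine ⟨fun n => (h.memLp_seq n).bounded_mul hb hK, h.memLp.bounded_mul hb hK, ?_⟩
  have h0 := ENNReal.Tendsto.const_mul (a := ENNReal.ofReal K) h.tendsto
    (Or.inr ENNReal.ofReal_ne_top)
  rw [mul_zero] at h0
  refine tendsto_of_tendsto_of_tendsto_of_le_of_le tendsto_const_nhds h0 (fun _ => zero_le)
    fun n => ?_
  refine eLpNorm_le_mul_eLpNorm_of_ae_le_mul ?_ 2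
  filter_upwards [hK] with x hx
  simp only [Pi.sub_apply]
  rw [← mul_sub, norm_mul, Real.norm_eq_abs]
  gcongr

/-- Continuity of the L² inner product. It carries both the weak formulation and Hardy's inequality
from test functions to `H¹₀`. -/
lemma TendstoL2.integral_mul {f f' : ℕ → X → ℝ} {g g' : X → ℝ} (h : TendstoL2 ν f g)
    (h' : TendstoL2 ν f' g') :
    Filter.Tendsto (fun n => ∫ x, f n x * f' n x ∂ν) Filter.atTop
      (nhds (∫ x, g x * g' x ∂ν)) := by
  have key : ∀ {a b : X → ℝ} (ha : MemLp a 2 ν) (hb : MemLp b 2 ν),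
      inner ℝ (hb.toLp b) (ha.toLp a) = ∫ x, a x * b x ∂ν := by
    intro a b ha hb
    rw [L2.inner_def]
    refine integral_congr_ae ?_
    filter_upwards [ha.coeFn_toLp, hb.coeFn_toLp] with x hx hx'
    rw [hx, hx']
    rfl
  have t1 := (Lp.tendsto_Lp_iff_tendsto_eLpNorm'' f h.memLp_seq g h.memLp).2 h.tendsto
  have t2 := (Lp.tendsto_Lp_iff_tendsto_eLpNorm'' f' h'.memLp_seq g' h'.memLp).2 h'.tendsto
  have t3 := t2.inner (𝕜 := ℝ) t1
  simpa only [key] using t3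

end TendstoL2

/-! ### The absorption argument. -/

section AbstractEnergy

variable {X : Type*} [MeasurableSpace X] {ν : Measure X} {ι κ : Type*} [Fintype ι] [Fintype κ]

/-- Young's inequality on every cross term. The product `a * c` is left alone, because coercivity
holds only after summing over the components. -/
lemma energy_pointwise {μ p a b c e : ℝ} (hμ : 0 < μ) :
    a * c - μ / 4 * c ^ 2 - (1 / μ + |p|) * b ^ 2 - |p| * a ^ 2 - 2 * |p| * e ^ 2 ≤
      (a + b) * (c + 2 * p * e) := by
  have h1 : -(μ / 4 * c ^ 2) - 1 / μ * b ^ 2 ≤ b * c := by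
    have : 0 ≤ μ * (c / 2 + b / μ) ^ 2 := by positivity
    have h : μ * (c / 2 + b / μ) ^ 2 = μ / 4 * c ^ 2 + b * c + 1 / μ * b ^ 2 := by
      field_simp; ring
    linarith
  have h2 : ∀ r : ℝ, -(|p| * (r ^ 2 + e ^ 2)) ≤ 2 * p * r * e := by
    intro r
    have h3 : |2 * r * e| ≤ r ^ 2 + e ^ 2 :=
      abs_le.2 ⟨by nlinarith [sq_nonneg (r + e)], by nlinarith [sq_nonneg (r - e)]⟩
    have h4 := mul_le_mul_of_nonneg_left h3 (abs_nonneg p)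
    rw [← abs_mul] at h4
    have h5 := neg_abs_le (p * (2 * r * e))
    linarith
  have h3 := h2 a
  have h4 := h2 b
  nlinarith

/-- The algebra of the weighted energy estimate: `g`, `h`, `F` stand for `w∇u`, `wA∇u`, `wf`, the
function `y` for `wu / ζ`, and `z` for the product of `y` and a gradient of size at most `1`. -/
lemma abstract_energy_estimate {μ K CH p : ℝ} (hμ : 0 < μ) (hCH : 0 ≤ CH)
    (hp1 : |p| ≤ 1) (hp2 : 4 * CH * Fintype.card κ * |p| ≤ 1)
    (hp3 : |p| * (K + 8 * Fintype.card κ * CH) ≤ μ / 4)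
    {g h F z : ι → κ → X → ℝ} {y : ι → X → ℝ}
    (hg : ∀ α i, MemLp (g α i) 2 ν) (hh : ∀ α i, MemLp (h α i) 2 ν)
    (hF : ∀ α i, MemLp (F α i) 2 ν) (hz : ∀ α i, MemLp (z α i) 2 ν) (hy : ∀ α, MemLp (y α) 2 ν)
    (hzy : ∀ α i x, |z α i x| ≤ |y α x|)
    (hid : ∑ α, ∑ i, ∫ x, (h α i x + F α i x) * (g α i x + 2 * p * z α i x) ∂ν = 0)
    (hcoer : ∀ᵐ x ∂ν, μ * ∑ α, ∑ i, g α i x ^ 2 ≤ ∑ α, ∑ i, h α i x * g α i x)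
    (hbd : ∀ᵐ x ∂ν, ∑ α, ∑ i, h α i x ^ 2 ≤ K * ∑ α, ∑ i, g α i x ^ 2)
    (hhardy : ∀ α, ∫ x, y α x ^ 2 ∂ν ≤ CH * ∑ i, ∫ x, (g α i x + p * z α i x) ^ 2 ∂ν) :
    ∫ x, ∑ α, ∑ i, g α i x ^ 2 ∂ν ≤ 2 / μ * (1 / μ + 1) * ∫ x, ∑ α, ∑ i, F α i x ^ 2 ∂ν := by
  have ig : ∀ α i, Integrable (fun x => g α i x ^ 2) ν := fun α i => (hg α i).integrable_sq
  have iF : ∀ α i, Integrable (fun x => F α i x ^ 2) ν := fun α i => (hF α i).integrable_sq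
  have iz : ∀ α i, Integrable (fun x => z α i x ^ 2) ν := fun α i => (hz α i).integrable_sq
  have iy : ∀ α, Integrable (fun x => y α x ^ 2) ν := fun α => (hy α).integrable_sq
  have iSg : Integrable (fun x => ∑ α, ∑ i, g α i x ^ 2) ν :=
    integrable_finsetSum _ fun α _ => integrable_finsetSum _ fun i _ => ig α i
  have iSF : Integrable (fun x => ∑ α, ∑ i, F α i x ^ 2) ν :=
    integrable_finsetSum _ fun α _ => integrable_finsetSum _ fun i _ => iF α i
  have iSz : Integrable (fun x => ∑ α, ∑ i, z α i x ^ 2) ν :=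
    integrable_finsetSum _ fun α _ => integrable_finsetSum _ fun i _ => iz α i
  have iQ : ∀ α i, Integrable (fun x => (h α i x + F α i x) * (g α i x + 2 * p * z α i x)) ν :=
    fun α i => ((hh α i).add (hF α i)).integrable_mul ((hg α i).add ((hz α i).const_mul (2 * p)))
  have hXsum : ∫ x, ∑ α, ∑ i, g α i x ^ 2 ∂ν = ∑ α, ∑ i, ∫ x, g α i x ^ 2 ∂ν := by
    rw [integral_finsetSum _ fun α _ => integrable_finsetSum _ fun i _ => ig α i]
    exact Finset.sum_congr rfl fun α _ => integral_finsetSum _ fun i _ => ig α i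
  have hZsum : ∫ x, ∑ α, ∑ i, z α i x ^ 2 ∂ν = ∑ α, ∑ i, ∫ x, z α i x ^ 2 ∂ν := by
    rw [integral_finsetSum _ fun α _ => integrable_finsetSum _ fun i _ => iz α i]
    exact Finset.sum_congr rfl fun α _ => integral_finsetSum _ fun i _ => iz α i
  have hzy2 : ∀ α i, ∫ x, z α i x ^ 2 ∂ν ≤ ∫ x, y α x ^ 2 ∂ν := fun α i =>
    integral_mono (iz α i) (iy α) fun x => sq_le_sq.2 (hzy α i x)
  -- Hardy's inequality has `y` on its right side too, through `z`. By `hp2` that contribution is at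
  -- most half of the left side.
  have hyg : ∀ α, ∫ x, y α x ^ 2 ∂ν ≤ 4 * CH * ∑ i, ∫ x, g α i x ^ 2 ∂ν := by
    intro α
    have h1 : ∀ i, ∫ x, (g α i x + p * z α i x) ^ 2 ∂ν ≤
        2 * ∫ x, g α i x ^ 2 ∂ν + 2 * |p| * ∫ x, y α x ^ 2 ∂ν := by
      intro i
      have h2 : ∫ x, (g α i x + p * z α i x) ^ 2 ∂ν ≤
          ∫ x, (2 * g α i x ^ 2 + 2 * |p| * z α i x ^ 2) ∂ν := by
        refine integral_mono ((hg α i).add ((hz α i).const_mul p)).integrable_sq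
          (((ig α i).const_mul _).add ((iz α i).const_mul _)) fun x => ?_
        simp only []
        have h3 : p ^ 2 ≤ |p| := by
          rw [← sq_abs]; nlinarith [abs_nonneg p]
        have h4 : p ^ 2 * z α i x ^ 2 ≤ |p| * z α i x ^ 2 := by gcongr
        nlinarith [sq_nonneg (g α i x - p * z α i x)]
      rw [integral_add ((ig α i).const_mul _) ((iz α i).const_mul _), integral_const_mul,
        integral_const_mul] at h2
      have h5 : 2 * |p| * ∫ x, z α i x ^ 2 ∂ν ≤ 2 * |p| * ∫ x, y α x ^ 2 ∂ν :=
        mul_le_mul_of_nonneg_left (hzy2 α i) (by positivity)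
      linarith
    have h6 : CH * ∑ i, ∫ x, (g α i x + p * z α i x) ^ 2 ∂ν ≤
        CH * ∑ i, (2 * ∫ x, g α i x ^ 2 ∂ν + 2 * |p| * ∫ x, y α x ^ 2 ∂ν) :=
      mul_le_mul_of_nonneg_left (Finset.sum_le_sum fun i _ => h1 i) hCH
    rw [Finset.sum_add_distrib, ← Finset.mul_sum, Finset.sum_const, Finset.card_univ,
      nsmul_eq_mul] at h6
    have hy0 : 0 ≤ ∫ x, y α x ^ 2 ∂ν := integral_nonneg fun x => sq_nonneg _
    have h7 := mul_le_mul_of_nonneg_right hp2 hy0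
    have h8 := hhardy α
    nlinarith
  set X0 := ∫ x, ∑ α, ∑ i, g α i x ^ 2 ∂ν with hX0
  set F0 := ∫ x, ∑ α, ∑ i, F α i x ^ 2 ∂ν with hF0
  set Z0 := ∫ x, ∑ α, ∑ i, z α i x ^ 2 ∂ν with hZ0
  have hZX : Z0 ≤ Fintype.card κ * (4 * CH * X0) := by
    rw [hZsum, hXsum, Finset.mul_sum, Finset.mul_sum]
    refine Finset.sum_le_sum fun α _ => ?_
    rw [← nsmul_eq_mul, ← Finset.card_univ]
    exact Finset.sum_le_card_nsmul _ _ _ fun i _ => (hzy2 α i).trans (hyg α)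
  -- Coercivity gives `μ`, of which Young's inequality spends `μ / 4`. The terms in `|p|`, including
  -- `z` through `hZX`, spend another `μ / 4` by `hp3`, leaving `μ / 2`.
  have hmain : ∫ x, ((3 * μ / 4 - |p| * K) * ∑ α, ∑ i, g α i x ^ 2 -
      (1 / μ + |p|) * ∑ α, ∑ i, F α i x ^ 2 - 2 * |p| * ∑ α, ∑ i, z α i x ^ 2) ∂ν ≤
      ∫ x, ∑ α, ∑ i, (h α i x + F α i x) * (g α i x + 2 * p * z α i x) ∂ν := by
    refine integral_mono_ae (((iSg.const_mul _).sub (iSF.const_mul _)).sub (iSz.const_mul _))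
      (integrable_finsetSum _ fun α _ => integrable_finsetSum _ fun i _ => iQ α i) ?_
    filter_upwards [hcoer, hbd] with x h1 h2
    have h3 := Finset.sum_le_sum fun α (_ : α ∈ Finset.univ) => Finset.sum_le_sum
      fun i (_ : i ∈ Finset.univ) =>
        energy_pointwise (p := p) (a := h α i x) (b := F α i x) (c := g α i x) (e := z α i x) hμ
    simp only [Finset.sum_sub_distrib, ← Finset.mul_sum] at h3
    have h4 := mul_le_mul_of_nonneg_left h2 (abs_nonneg p)
    linarith
  have iSgF : Integrable (fun x => (3 * μ / 4 - |p| * K) * ∑ α, ∑ i, g α i x ^ 2 -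
      (1 / μ + |p|) * ∑ α, ∑ i, F α i x ^ 2) ν := (iSg.const_mul _).sub (iSF.const_mul _)
  rw [integral_sub iSgF (iSz.const_mul _),
    integral_sub (iSg.const_mul _) (iSF.const_mul _), integral_const_mul, integral_const_mul,
    integral_const_mul,
    integral_finsetSum _ fun α _ => integrable_finsetSum _ fun i _ => iQ α i,
    Finset.sum_congr rfl fun α _ => integral_finsetSum _ fun i _ => iQ α i, hid] at hmain
  have hX0n : 0 ≤ X0 := integral_nonneg fun x => by positivity
  have hF0n : 0 ≤ F0 := integral_nonneg fun x => by positivity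
  have h1 := mul_le_mul_of_nonneg_right hp3 hX0n
  have h2 := mul_le_mul_of_nonneg_left hZX (abs_nonneg p)
  have h3 := mul_le_mul_of_nonneg_right hp1 hF0n
  have h4 : μ / 2 * X0 ≤ (1 / μ + 1) * F0 := by nlinarith
  calc X0 = 2 / μ * (μ / 2 * X0) := by field_simp
    _ ≤ 2 / μ * ((1 / μ + 1) * F0) := by gcongr
    _ = _ := by ring

end AbstractEnergy

/-! ### The energy estimate with a smooth weight. -/

section WeightedEnergy

variable {d m : ℕ} {Ω : Set (EuclideanSpace ℝ (Fin d))}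

lemma ae_restrict_exists_bound (hΩ : Bornology.IsBounded Ω) (ho : IsOpen Ω)
    {b : EuclideanSpace ℝ (Fin d) → ℝ} (hb : Continuous b) :
    ∃ K : ℝ, ∀ᵐ x ∂(volume.restrict Ω), |b x| ≤ K := by
  obtain ⟨K, hK⟩ := hΩ.isCompact_closure.exists_bound_of_continuousOn hb.continuousOn
  refine ⟨K, ?_⟩
  filter_upwards [ae_restrict_mem ho.measurableSet] with x hx using hK x (subset_closure hx)

lemma MeasureTheory.MemLp.continuous_mul (hΩ : Bornology.IsBounded Ω) (ho : IsOpen Ω)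
    {b g : EuclideanSpace ℝ (Fin d) → ℝ} (hb : Continuous b)
    (hg : MemLp g 2 (volume.restrict Ω)) : MemLp (fun x => b x * g x) 2 (volume.restrict Ω) := by
  obtain ⟨K, hK⟩ := ae_restrict_exists_bound hΩ ho hb
  exact hg.bounded_mul hb.aestronglyMeasurable hK

lemma TendstoL2.continuous_mul (hΩ : Bornology.IsBounded Ω) (ho : IsOpen Ω)
    {b g : EuclideanSpace ℝ (Fin d) → ℝ} {f : ℕ → EuclideanSpace ℝ (Fin d) → ℝ}
    (hb : Continuous b) (h : TendstoL2 (volume.restrict Ω) f g) :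
    TendstoL2 (volume.restrict Ω) (fun n x => b x * f n x) (fun x => b x * g x) := by
  obtain ⟨K, hK⟩ := ae_restrict_exists_bound hΩ ho hb
  exact h.bounded_mul hb.aestronglyMeasurable hK

lemma continuous_partialDeriv {φ : EuclideanSpace ℝ (Fin d) → ℝ} (hφ : ContDiff ℝ ∞ φ)
    (i : Fin d) : Continuous (partialDeriv i φ) :=
  (hφ.continuous_fderiv (by simp)).clm_apply continuous_const

lemma MemH10.exists_seq {u : EuclideanSpace ℝ (Fin d) → ℝ}
    {g : Fin d → EuclideanSpace ℝ (Fin d) → ℝ} (hu : MemH10 Ω u g) :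
    ∃ φ : ℕ → EuclideanSpace ℝ (Fin d) → ℝ, (∀ n, IsTestFunction Ω (φ n)) ∧
      TendstoL2 (volume.restrict Ω) φ u ∧
      ∀ i, TendstoL2 (volume.restrict Ω) (fun n => partialDeriv i (φ n)) (g i) := by
  have h : ∀ n : ℕ, (0 : ℝ≥0∞) < ((n : ℝ≥0∞) + 1)⁻¹ := fun n => by simp
  choose φ hφ hφu hφg using fun n => hu.mem_closure _ (h n)
  have hlim : Filter.Tendsto (fun n : ℕ => ((n : ℝ≥0∞) + 1)⁻¹) Filter.atTop (nhds 0) := by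
    have := ENNReal.tendsto_inv_nat_nhds_zero.comp (Filter.tendsto_add_atTop_nat 1)
    refine this.congr fun n => ?_
    simp
  refine ⟨φ, hφ, ⟨fun n => ?_, hu.memH1.memLp, ?_⟩, fun i => ⟨fun n => ?_, hu.memH1.grad_memLp i, ?_⟩⟩
  · exact ((hφ n).contDiff.continuous.memLp_of_hasCompactSupport
      (hφ n).hasCompactSupport).restrict Ω
  · refine tendsto_of_tendsto_of_tendsto_of_le_of_le tendsto_const_nhds hlim (fun _ => zero_le)
      fun n => ?_
    rw [eLpNorm_sub_comm]
    exact hφu n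
  · exact ((continuous_partialDeriv (hφ n).contDiff i).memLp_of_hasCompactSupport
      ((hφ n).hasCompactSupport.fderiv_apply ℝ _)).restrict Ω
  · refine tendsto_of_tendsto_of_tendsto_of_le_of_le tendsto_const_nhds hlim (fun _ => zero_le)
      fun n => ?_
    rw [eLpNorm_sub_comm]
    exact hφg n i

/-- Multiplication by a smooth function acts continuously on the gradients. -/
lemma TendstoL2.partialDeriv_mul (hΩ : Bornology.IsBounded Ω) (ho : IsOpen Ω)
    {φ : ℕ → EuclideanSpace ℝ (Fin d) → ℝ} {u g w : EuclideanSpace ℝ (Fin d) → ℝ} {i : Fin d}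
    (hφ : ∀ n, IsTestFunction Ω (φ n)) (hw : ContDiff ℝ ∞ w)
    (hu : TendstoL2 (volume.restrict Ω) φ u)
    (hg : TendstoL2 (volume.restrict Ω) (fun n => partialDeriv i (φ n)) g) :
    TendstoL2 (volume.restrict Ω) (fun n => partialDeriv i (fun x => w x * φ n x))
      (fun x => w x * g x + partialDeriv i w x * u x) := by
  have h := (hg.continuous_mul hΩ ho hw.continuous).add
    (hu.continuous_mul hΩ ho (continuous_partialDeriv hw i))
  have e : (fun n => partialDeriv i (fun x => w x * φ n x)) =
      fun n x => w x * partialDeriv i (φ n) x + partialDeriv i w x * φ n x := by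
    funext n x
    rw [_root_.partialDeriv_mul hw (hφ n).contDiff, mul_comm (φ n x)]
  rw [e]
  exact h

/-- Hardy's inequality for the product of an `H¹₀` function with a smooth function. -/
lemma MemH10.hardy (hΩ : Bornology.IsBounded Ω) (ho : IsOpen Ω) {CH : ℝ}
    {b w u : EuclideanSpace ℝ (Fin d) → ℝ} {g : Fin d → EuclideanSpace ℝ (Fin d) → ℝ}
    (hHardy : ∀ φ, IsTestFunction Ω φ →
      ∫ x in Ω, (b x * φ x) ^ 2 ≤ CH * ∑ i, ∫ x in Ω, partialDeriv i φ x ^ 2)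
    (hb : Continuous b) (hw : ContDiff ℝ ∞ w) (hu : MemH10 Ω u g) :
    ∫ x in Ω, (b x * (w x * u x)) ^ 2 ≤
      CH * ∑ i, ∫ x in Ω, (w x * g i x + partialDeriv i w x * u x) ^ 2 := by
  obtain ⟨φ, hφ, hφu, hφg⟩ := hu.exists_seq
  have t1 := (hφu.continuous_mul hΩ ho hw.continuous).continuous_mul hΩ ho hb
  have t1' := t1.integral_mul t1
  have t2 := fun i => (hφu.partialDeriv_mul hΩ ho hφ hw (hφg i)).integral_mul
    (hφu.partialDeriv_mul hΩ ho hφ hw (hφg i))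
  have t2' := (tendsto_finsetSum Finset.univ fun i _ => t2 i).const_mul CH
  simp only [← pow_two] at t1' t2'
  exact le_of_tendsto_of_tendsto' t1' t2' fun n => hHardy _ ((hφ n).mul_left hw)

/-- The flux `(A∇u)_i^α`. -/
noncomputable def flux (A : Fin m → Fin m → Fin d → Fin d → EuclideanSpace ℝ (Fin d) → ℝ)
    (G : Fin m → Fin d → EuclideanSpace ℝ (Fin d) → ℝ) (α : Fin m) (i : Fin d)
    (x : EuclideanSpace ℝ (Fin d)) : ℝ :=
  ∑ β, ∑ j, A α β i j x * G β j x

variable {μ : ℝ} {A : Fin m → Fin m → Fin d → Fin d → EuclideanSpace ℝ (Fin d) → ℝ}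
  {G f : Fin m → Fin d → EuclideanSpace ℝ (Fin d) → ℝ} {u : Fin m → EuclideanSpace ℝ (Fin d) → ℝ}

lemma memLp_flux (hA : IsElliptic μ A) (hG : ∀ α i, MemLp (G α i) 2 (volume.restrict Ω))
    (α : Fin m) (i : Fin d) : MemLp (flux A G α i) 2 (volume.restrict Ω) := by
  refine memLp_finsetSum _ fun β _ => memLp_finsetSum _ fun j _ => ?_
  refine (hG β j).bounded_mul (K := μ⁻¹) (hA.aemeasurable α β i j).restrict.aestronglyMeasurable ?_
  filter_upwards [ae_restrict_of_ae hA.bounded] with x hx using hx α β i j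

lemma sum_flux_mul (ξ : Fin m → Fin d → ℝ) (x : EuclideanSpace ℝ (Fin d)) :
    ∑ α, ∑ β, ∑ i, ∑ j, A α β i j x * G β j x * ξ α i = ∑ α, ∑ i, flux A G α i x * ξ α i := by
  refine Finset.sum_congr rfl fun α _ => ?_
  rw [Finset.sum_comm]
  refine Finset.sum_congr rfl fun i _ => ?_
  simp only [flux, Finset.sum_mul]

lemma IsElliptic.sum_sq_le_sum_flux_mul (hA : IsElliptic μ A) :
    ∀ᵐ x : EuclideanSpace ℝ (Fin d),
      μ * ∑ α, ∑ i, G α i x ^ 2 ≤ ∑ α, ∑ i, flux A G α i x * G α i x := by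
  filter_upwards [hA.coercive] with x hx
  rw [← sum_flux_mul]
  refine (hx fun α i => G α i x).trans_eq ?_
  simp only [mul_right_comm]

/-- Cauchy–Schwarz over the `m * d` terms of each flux component gives one factor `m * d`; summing
the components gives the other. -/
lemma IsElliptic.sum_flux_sq_le (hA : IsElliptic μ A) :
    ∀ᵐ x : EuclideanSpace ℝ (Fin d),
      ∑ α, ∑ i, flux A G α i x ^ 2 ≤ (m * d) ^ 2 * μ⁻¹ ^ 2 * ∑ α, ∑ i, G α i x ^ 2 := by
  filter_upwards [hA.bounded] with x hx
  have h1 : ∀ α i, flux A G α i x ^ 2 ≤ (m * d) * μ⁻¹ ^ 2 * ∑ α, ∑ i, G α i x ^ 2 := by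
    intro α i
    simp only [flux, ← Finset.sum_product']
    refine (Finset.sum_mul_sq_le_sq_mul_sq _ _ _).trans ?_
    refine mul_le_mul_of_nonneg_right ?_ (Finset.sum_nonneg fun _ _ => sq_nonneg _)
    have h2 : ∀ q ∈ (Finset.univ : Finset (Fin m)) ×ˢ (Finset.univ : Finset (Fin d)),
        A α q.1 i q.2 x ^ 2 ≤ μ⁻¹ ^ 2 := fun q _ =>
      sq_le_sq.2 ((hx α q.1 i q.2).trans (le_abs_self _))
    refine (Finset.sum_le_card_nsmul _ _ _ h2).trans_eq ?_
    simp
  calc _ ≤ ∑ _α : Fin m, ∑ _i : Fin d, (m * d) * μ⁻¹ ^ 2 * ∑ α, ∑ i, G α i x ^ 2 :=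
        Finset.sum_le_sum fun α _ => Finset.sum_le_sum fun i _ => h1 α i
    _ = _ := by
      simp only [Finset.sum_const, Finset.card_univ, Fintype.card_fin, nsmul_eq_mul]
      ring

/-- The weak formulation tested with `η u`, for a smooth function `η`. -/
lemma IsWeakSolution.sum_integral_eq_zero (hΩ : Bornology.IsBounded Ω) (ho : IsOpen Ω)
    (hA : IsElliptic μ A) (hf : ∀ α i, MemLp (f α i) 2 (volume.restrict Ω))
    (hu : ∀ α, MemH10 Ω (u α) (G α)) (hsol : IsWeakSolution Ω A G f)
    {η : EuclideanSpace ℝ (Fin d) → ℝ} (hη : ContDiff ℝ ∞ η) :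
    ∑ α, ∑ i, ∫ x in Ω, (flux A G α i x + f α i x) *
      (η x * G α i x + partialDeriv i η x * u α x) = 0 := by
  choose φ hφ hφu hφg using fun α => (hu α).exists_seq
  have hH := memLp_flux hA fun α i => (hu α).memH1.grad_memLp i
  have t0 := fun α i => (hφu α).partialDeriv_mul hΩ ho (hφ α) hη (hφg α i)
  have t1 := fun α i => (TendstoL2.const ((hH α i).add (hf α i))).integral_mul (t0 α i)
  have t2 := tendsto_finsetSum Finset.univ fun α _ =>
    tendsto_finsetSum Finset.univ fun i _ => t1 α i
  -- Along the approximations `η φ_n`, which are admissible test functions, the expression is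
  -- identically zero.
  refine tendsto_nhds_unique t2 (tendsto_const_nhds.congr fun n => ?_)
  have h1 := hsol (fun α x => η x * φ α n x) fun α => (hφ α n).mul_left hη
  simp only [sum_flux_mul] at h1
  have i1 := fun α i => (hH α i).integrable_mul ((t0 α i).memLp_seq n)
  have i2 := fun α i => (hf α i).integrable_mul ((t0 α i).memLp_seq n)
  simp only [Pi.mul_def] at i1 i2
  rw [integral_finsetSum _ fun α _ => integrable_finsetSum _ fun i _ => i1 α i,
    integral_finsetSum _ fun α _ => integrable_finsetSum _ fun i _ => i2 α i,
    Finset.sum_congr rfl fun α _ => integral_finsetSum _ fun i _ => i1 α i,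
    Finset.sum_congr rfl fun α _ => integral_finsetSum _ fun i _ => i2 α i,
    ← sub_eq_zero, sub_neg_eq_add, ← Finset.sum_add_distrib] at h1
  rw [← h1]
  refine Finset.sum_congr rfl fun α _ => ?_
  rw [← Finset.sum_add_distrib]
  refine Finset.sum_congr rfl fun i _ => ?_
  rw [← integral_add (i1 α i) (i2 α i)]
  refine integral_congr_ae (ae_of_all _ fun x => ?_)
  simp only [Pi.add_apply]
  ring

lemma partialDeriv_rpow {ζ : EuclideanSpace ℝ (Fin d) → ℝ} (hζ : ContDiff ℝ ∞ ζ)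
    (hpos : ∀ x, 0 < ζ x) (p : ℝ) (i : Fin d) (x : EuclideanSpace ℝ (Fin d)) :
    partialDeriv i (fun x => ζ x ^ p) x = p * ζ x ^ (p - 1) * partialDeriv i ζ x := by
  have h := ((hζ.differentiable (by simp) x).hasFDerivAt.rpow_const (p := p) (Or.inl (hpos x).ne'))
  simp [partialDeriv, h.fderiv]

/-- The weighted energy estimate for a smooth positive weight `ζ ^ σ` such that
`dist(·, ∂Ω) ≤ ζ` and `|∂_i ζ| ≤ 1`. -/
lemma IsWeakSolution.smooth_weighted_estimate (hΩ : Bornology.IsBounded Ω) (ho : IsOpen Ω)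
    (hμ : 0 < μ) (hA : IsElliptic μ A) (hf : ∀ α i, MemLp (f α i) 2 (volume.restrict Ω))
    (hu : ∀ α, MemH10 Ω (u α) (G α)) (hsol : IsWeakSolution Ω A G f) {CH : ℝ} (hCH : 0 ≤ CH)
    (hHardy : ∀ φ, IsTestFunction Ω φ → ∀ b : EuclideanSpace ℝ (Fin d) → ℝ,
      (∀ x ∈ Ω, |b x| * Metric.infDist x (frontier Ω) ≤ 1) →
      ∫ x in Ω, (b x * φ x) ^ 2 ≤ CH * ∑ i, ∫ x in Ω, partialDeriv i φ x ^ 2)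
    {ζ : EuclideanSpace ℝ (Fin d) → ℝ} (hζ : ContDiff ℝ ∞ ζ) (hpos : ∀ x, 0 < ζ x)
    (hζ1 : ∀ i x, |partialDeriv i ζ x| ≤ 1)
    (hζδ : ∀ x, Metric.infDist x (frontier Ω) ≤ ζ x) {σ : ℝ}
    (hp1 : |σ / 2| ≤ 1) (hp2 : 4 * CH * d * |σ / 2| ≤ 1)
    (hp3 : |σ / 2| * ((m * d) ^ 2 * μ⁻¹ ^ 2 + 8 * d * CH) ≤ μ / 4) :
    Integrable (fun x => (∑ α, ∑ i, G α i x ^ 2) * ζ x ^ σ) (volume.restrict Ω) ∧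
    Integrable (fun x => (∑ α, ∑ i, f α i x ^ 2) * ζ x ^ σ) (volume.restrict Ω) ∧
    ∫ x in Ω, (∑ α, ∑ i, G α i x ^ 2) * ζ x ^ σ ≤
      2 / μ * (1 / μ + 1) * ∫ x in Ω, (∑ α, ∑ i, f α i x ^ 2) * ζ x ^ σ := by
  set w : EuclideanSpace ℝ (Fin d) → ℝ := fun x => ζ x ^ (σ / 2) with hw_def
  have hw : ContDiff ℝ ∞ w := hζ.rpow_const_of_ne fun x => (hpos x).ne'
  have hη : ContDiff ℝ ∞ fun x => ζ x ^ σ := hζ.rpow_const_of_ne fun x => (hpos x).ne'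
  have hb : Continuous fun x => (ζ x)⁻¹ := hζ.continuous.inv₀ fun x => (hpos x).ne'
  have hw2 : ∀ x, w x ^ 2 = ζ x ^ σ := fun x => by
    rw [hw_def]
    simp only []
    rw [← Real.rpow_natCast, ← Real.rpow_mul (hpos x).le]
    norm_num
  have hG : ∀ α i, MemLp (G α i) 2 (volume.restrict Ω) := fun α i => (hu α).memH1.grad_memLp i
  have hH := memLp_flux hA hG
  have hsq : ∀ F : Fin m → Fin d → EuclideanSpace ℝ (Fin d) → ℝ,
      (fun x => ∑ α, ∑ i, (w x * F α i x) ^ 2) =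
        fun x => (∑ α, ∑ i, F α i x ^ 2) * ζ x ^ σ := by
    intro F
    funext x
    simp only [mul_pow, ← Finset.mul_sum, hw2]
    rw [mul_comm]
  have hint : ∀ F : Fin m → Fin d → EuclideanSpace ℝ (Fin d) → ℝ,
      (∀ α i, MemLp (F α i) 2 (volume.restrict Ω)) →
      Integrable (fun x => (∑ α, ∑ i, F α i x ^ 2) * ζ x ^ σ) (volume.restrict Ω) := by
    intro F hF
    rw [← hsq]
    exact integrable_finsetSum _ fun α _ => integrable_finsetSum _ fun i _ =>
      ((hF α i).continuous_mul hΩ ho hw.continuous).integrable_sq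
  refine ⟨hint G hG, hint f hf, ?_⟩
  have hy : ∀ α, MemLp (fun x => (ζ x)⁻¹ * (w x * u α x)) 2 (volume.restrict Ω) := fun α =>
    ((hu α).memH1.memLp.continuous_mul hΩ ho hw.continuous).continuous_mul hΩ ho hb
  have hwd : ∀ i x, partialDeriv i w x = σ / 2 * (partialDeriv i ζ x * ((ζ x)⁻¹ * w x)) := by
    intro i x
    rw [hw_def, partialDeriv_rpow hζ hpos, Real.rpow_sub_one (hpos x).ne']
    ring
  have hηd : ∀ i x, partialDeriv i (fun x => ζ x ^ σ) x =
      σ * (partialDeriv i ζ x * ((ζ x)⁻¹ * w x ^ 2)) := by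
    intro i x
    rw [hw2, partialDeriv_rpow hζ hpos, Real.rpow_sub_one (hpos x).ne']
    ring
  rw [← hsq G, ← hsq f]
  -- With `w = ζ^(σ/2)`, the gradient of `w u` is `g + p z`, while that of the test function `w² u`
  -- is `w (g + 2 p z)`. This is why Hardy's inequality carries `p` and the weak formulation `2 p`.
  refine abstract_energy_estimate (K := (m * d) ^ 2 * μ⁻¹ ^ 2) (CH := CH) (p := σ / 2)
    (h := fun α i x => w x * flux A G α i x)
    (z := fun α i x => partialDeriv i ζ x * ((ζ x)⁻¹ * (w x * u α x)))
    (y := fun α x => (ζ x)⁻¹ * (w x * u α x)) hμ hCH hp1 (by simpa using hp2) (by simpa using hp3)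
    (fun α i => (hG α i).continuous_mul hΩ ho hw.continuous)
    (fun α i => (hH α i).continuous_mul hΩ ho hw.continuous)
    (fun α i => (hf α i).continuous_mul hΩ ho hw.continuous)
    (fun α i => (hy α).continuous_mul hΩ ho (continuous_partialDeriv hζ i)) hy ?_ ?_ ?_ ?_ ?_
  · intro α i x
    rw [abs_mul]
    exact mul_le_of_le_one_left (abs_nonneg _) (hζ1 i x)
  · rw [← hsol.sum_integral_eq_zero hΩ ho hA hf hu hη]
    refine Finset.sum_congr rfl fun α _ => Finset.sum_congr rfl fun i _ =>
      integral_congr_ae (ae_of_all _ fun x => ?_)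
    beta_reduce
    rw [hηd, ← hw2]
    ring
  · filter_upwards [ae_restrict_of_ae (hA.sum_sq_le_sum_flux_mul (G := G))] with x hx
    have h := mul_le_mul_of_nonneg_left hx (sq_nonneg (w x))
    simp only [mul_pow, ← Finset.mul_sum]
    refine (le_of_eq (by ring)).trans (h.trans_eq ?_)
    simp only [Finset.mul_sum]
    exact Finset.sum_congr rfl fun α _ => Finset.sum_congr rfl fun i _ => by ring
  · filter_upwards [ae_restrict_of_ae (hA.sum_flux_sq_le (G := G))] with x hx
    have h := mul_le_mul_of_nonneg_left hx (sq_nonneg (w x))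
    simp only [mul_pow, ← Finset.mul_sum] at h ⊢
    linarith
  · intro α
    refine ((hu α).hardy hΩ ho (fun φ hφ => hHardy φ hφ _ fun x _ => ?_) hb hw).trans_eq ?_
    · rw [abs_of_pos (inv_pos.2 (hpos x)), inv_mul_le_iff₀ (hpos x), mul_one]
      exact hζδ x
    · congr 1
      refine Finset.sum_congr rfl fun i _ => integral_congr_ae (ae_of_all _ fun x => ?_)
      simp only [hwd]
      ring

end WeightedEnergy

/-! ### Smooth majorants of the distance function. -/

section SmoothDistance

variable {d : ℕ}

/-- The convolution averages translates of `g` against a nonnegative kernel of mass 1, so the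
Lipschitz constant is kept. -/
lemma ContDiffBump.lipschitzWith_normed_convolution
    (χ : ContDiffBump (0 : EuclideanSpace ℝ (Fin d))) {g : EuclideanSpace ℝ (Fin d) → ℝ}
    (hg : LipschitzWith 1 g) :
    LipschitzWith 1 (convolution (χ.normed volume) g (ContinuousLinearMap.lsmul ℝ ℝ) volume) := by
  refine LipschitzWith.of_dist_le_mul fun x y => ?_
  have hint : ∀ x, Integrable fun t => χ.normed volume t • g (x - t) := fun x => by
    have hg' := hg.continuous
    refine Continuous.integrable_of_hasCompactSupport ?_ χ.hasCompactSupport_normed.smul_right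
    exact χ.continuous_normed.smul (by fun_prop)
  rw [convolution_lsmul, convolution_lsmul, dist_eq_norm, ← integral_sub (hint x) (hint y)]
  have hbound : Integrable fun t => χ.normed volume t * dist x y :=
    (χ.integrable_normed).mul_const _
  refine (norm_integral_le_of_norm_le hbound (ae_of_all _ fun t => ?_)).trans_eq ?_
  · rw [← smul_sub, norm_smul, Real.norm_of_nonneg (χ.nonneg_normed t), ← dist_eq_norm]
    refine mul_le_mul_of_nonneg_left ?_ (χ.nonneg_normed t)
    simpa using hg.dist_le_mul (x - t) (y - t)
  · rw [integral_mul_const, χ.integral_normed]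
    simp

/-- A smooth function between `dist(·, s)` and `dist(·, s) + 2ε` with gradient at most `1`. -/
lemma exists_smooth_infDist (s : Set (EuclideanSpace ℝ (Fin d))) {ε : ℝ} (hε : 0 < ε) :
    ∃ ζ : EuclideanSpace ℝ (Fin d) → ℝ, ContDiff ℝ ∞ ζ ∧ (∀ x, 0 < ζ x) ∧
      (∀ i x, |partialDeriv i ζ x| ≤ 1) ∧ (∀ x, Metric.infDist x s ≤ ζ x) ∧
      ∀ x, ζ x ≤ Metric.infDist x s + 2 * ε := by
  let χ : ContDiffBump (0 : EuclideanSpace ℝ (Fin d)) := ⟨ε / 4, ε / 2, by positivity, by linarith⟩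
  set δ : EuclideanSpace ℝ (Fin d) → ℝ := fun x => Metric.infDist x s with hδ_def
  have hδ : LipschitzWith 1 δ := Metric.lipschitz_infDist_pt s
  set ζ₀ := convolution (χ.normed volume) δ (ContinuousLinearMap.lsmul ℝ ℝ) volume with hζ₀
  have hclose : ∀ x, |ζ₀ x - δ x| ≤ ε / 2 := fun x => by
    rw [← Real.dist_eq]
    refine ContDiffBump.dist_normed_convolution_le hδ.continuous.aestronglyMeasurable fun y hy => ?_
    refine (hδ.dist_le_mul y x).trans ?_
    simpa using (Metric.mem_ball.1 hy).le
  have hlip : LipschitzWith 1 (fun x => ζ₀ x + ε) := by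
    simpa using (χ.lipschitzWith_normed_convolution hδ).add (LipschitzWith.const ε)
  -- Mollification at scale `ε / 2` moves δ by at most `ε / 2`, so adding `ε` places the function
  -- between `δ + ε / 2` and `δ + 3ε / 2`.
  refine ⟨fun x => ζ₀ x + ε, ?_, fun x => ?_, fun i x => ?_, fun x => ?_, fun x => ?_⟩
  · exact (χ.hasCompactSupport_normed.contDiff_convolution_left _ χ.contDiff_normed
      hδ.continuous.locallyIntegrable).add contDiff_const
  · have h := abs_le.1 (hclose x)
    have h0 : 0 ≤ δ x := Metric.infDist_nonneg
    linarith
  · have h := (fderiv ℝ (fun x => ζ₀ x + ε) x).le_opNorm (EuclideanSpace.single i 1)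
    rw [PiLp.norm_single, norm_one, mul_one] at h
    exact h.trans (norm_fderiv_le_of_lipschitz ℝ hlip)
  · have h := abs_le.1 (hclose x)
    change δ x ≤ _
    linarith
  · have h := abs_le.1 (hclose x)
    change _ ≤ δ x + _
    linarith

end SmoothDistance

/-! ### From smooth weights to the distance. -/

section Limit

variable {d m : ℕ} {Ω : Set (EuclideanSpace ℝ (Fin d))}
  {G f : Fin m → Fin d → EuclideanSpace ℝ (Fin d) → ℝ}

/-- Fatou's lemma handles the left side for either sign of `σ`. On the right, `ζ^σ ≤ δ^σ` if `σ ≤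
0`, since `ζ ≥ δ`; if `σ > 0` the weights are uniformly bounded on Ω and dominated convergence
applies. -/
lemma weightedEnergy_le_of_forall_smooth (hd : 0 < d) (hΩ : Bornology.IsBounded Ω) (ho : IsOpen Ω)
    (hf : ∀ α i, MemLp (f α i) 2 (volume.restrict Ω)) {C σ : ℝ} (hC : 0 ≤ C)
    (h : ∀ ζ : EuclideanSpace ℝ (Fin d) → ℝ, ContDiff ℝ ∞ ζ → (∀ x, 0 < ζ x) →
      (∀ i x, |partialDeriv i ζ x| ≤ 1) → (∀ x, Metric.infDist x (frontier Ω) ≤ ζ x) →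
      Integrable (fun x => (∑ α, ∑ i, G α i x ^ 2) * ζ x ^ σ) (volume.restrict Ω) ∧
      Integrable (fun x => (∑ α, ∑ i, f α i x ^ 2) * ζ x ^ σ) (volume.restrict Ω) ∧
      ∫ x in Ω, (∑ α, ∑ i, G α i x ^ 2) * ζ x ^ σ ≤
        C * ∫ x in Ω, (∑ α, ∑ i, f α i x ^ 2) * ζ x ^ σ) :
    weightedEnergy Ω σ G ≤ ENNReal.ofReal C * weightedEnergy Ω σ f := by
  choose ζ hζ hpos hζ1 hle hge using fun n : ℕ =>
    exists_smooth_infDist (frontier Ω) (ε := 1 / ((n : ℝ) + 1)) (by positivity)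
  choose iG iF hGF using fun n => h (ζ n) (hζ n) (hpos n) (hζ1 n) (hle n)
  have hlim : ∀ x, Filter.Tendsto (fun n => ζ n x) Filter.atTop
      (nhds (Metric.infDist x (frontier Ω))) := by
    intro x
    have h0 := ((tendsto_one_div_add_atTop_nhds_zero_nat (𝕜 := ℝ)).const_mul 2).const_add
      (Metric.infDist x (frontier Ω))
    rw [mul_zero, add_zero] at h0
    exact tendsto_of_tendsto_of_tendsto_of_le_of_le tendsto_const_nhds h0 (fun n => hle n x)
      fun n => hge n x
  have hlimF : ∀ (F : Fin m → Fin d → EuclideanSpace ℝ (Fin d) → ℝ), ∀ x ∈ Ω,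
      Filter.Tendsto (fun n => ENNReal.ofReal ((∑ α, ∑ i, F α i x ^ 2) * ζ n x ^ σ))
        Filter.atTop (nhds (ENNReal.ofReal
          ((∑ α, ∑ i, F α i x ^ 2) * Metric.infDist x (frontier Ω) ^ σ))) := by
    intro F x hx
    refine ENNReal.tendsto_ofReal (((hlim x).rpow_const ?_).const_mul _)
    exact Or.inl (infDist_frontier_pos hd hΩ ho hx).ne'
  have hfatou : weightedEnergy Ω σ G ≤ Filter.liminf (fun n => ∫⁻ x in Ω,
      ENNReal.ofReal ((∑ α, ∑ i, G α i x ^ 2) * ζ n x ^ σ)) Filter.atTop := by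
    refine le_trans (le_of_eq ?_)
      (lintegral_liminf_le' fun n => (iG n).1.aemeasurable.ennreal_ofReal)
    refine lintegral_congr_ae ?_
    filter_upwards [ae_restrict_mem ho.measurableSet] with x hx
    exact (hlimF G x hx).liminf_eq.symm
  have hstep : ∀ n, ∫⁻ x in Ω, ENNReal.ofReal ((∑ α, ∑ i, G α i x ^ 2) * ζ n x ^ σ) ≤
      ENNReal.ofReal C *
        ∫⁻ x in Ω, ENNReal.ofReal ((∑ α, ∑ i, f α i x ^ 2) * ζ n x ^ σ) := by
    intro n
    have hn : ∀ (F : Fin m → Fin d → EuclideanSpace ℝ (Fin d) → ℝ) x,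
        0 ≤ (∑ α, ∑ i, F α i x ^ 2) * ζ n x ^ σ := fun F x =>
      mul_nonneg (Finset.sum_nonneg fun _ _ => Finset.sum_nonneg fun _ _ => sq_nonneg _)
        (Real.rpow_nonneg (hpos n x).le _)
    rw [← ofReal_integral_eq_lintegral_ofReal (iG n) (ae_of_all _ (hn G)),
      ← ofReal_integral_eq_lintegral_ofReal (iF n) (ae_of_all _ (hn f)), ← ENNReal.ofReal_mul hC]
    exact ENNReal.ofReal_le_ofReal (hGF n)
  refine hfatou.trans ((Filter.liminf_le_liminf (Filter.Eventually.of_forall hstep)).trans ?_)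
  rcases le_or_gt σ 0 with hσ | hσ
  · have hmono : ∀ n, ENNReal.ofReal C *
        ∫⁻ x in Ω, ENNReal.ofReal ((∑ α, ∑ i, f α i x ^ 2) * ζ n x ^ σ) ≤
        ENNReal.ofReal C * weightedEnergy Ω σ f := by
      intro n
      refine mul_le_mul_right (lintegral_mono_ae ?_) _
      filter_upwards [ae_restrict_mem ho.measurableSet] with x hx
      refine ENNReal.ofReal_le_ofReal (mul_le_mul_of_nonneg_left ?_ ?_)
      · exact Real.rpow_le_rpow_of_nonpos (infDist_frontier_pos hd hΩ ho hx) (hle n x) hσ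
      · exact Finset.sum_nonneg fun _ _ => Finset.sum_nonneg fun _ _ => sq_nonneg _
    refine (Filter.liminf_le_liminf (Filter.Eventually.of_forall hmono)).trans_eq ?_
    exact tendsto_const_nhds.liminf_eq
  · refine (ENNReal.Tendsto.const_mul ?_ (Or.inr ENNReal.ofReal_ne_top)).liminf_eq.le
    obtain ⟨K, hK⟩ := ae_restrict_exists_bound hΩ ho
      (Metric.continuous_infDist_pt (frontier Ω))
    have iS : Integrable (fun x => (∑ α, ∑ i, f α i x ^ 2) * (K + 2) ^ σ)
        (volume.restrict Ω) :=
      (integrable_finsetSum _ fun α _ => integrable_finsetSum _ fun i _ =>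
        (hf α i).integrable_sq).mul_const _
    refine tendsto_lintegral_of_dominated_convergence' _
      (fun n => (iF n).1.aemeasurable.ennreal_ofReal) (fun n => ?_) iS.lintegral_lt_top.ne ?_
    · filter_upwards [hK] with x hx
      refine ENNReal.ofReal_le_ofReal (mul_le_mul_of_nonneg_left ?_ ?_)
      · refine Real.rpow_le_rpow (hpos n x).le ?_ hσ.le
        have h1 : 1 / ((n : ℝ) + 1) ≤ 1 := by
          rw [div_le_one (by positivity)]
          linarith [(Nat.cast_nonneg n : (0 : ℝ) ≤ n)]
        linarith [hge n x, le_abs_self (Metric.infDist x (frontier Ω))]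
      · exact Finset.sum_nonneg fun _ _ => Finset.sum_nonneg fun _ _ => sq_nonneg _
    · filter_upwards [ae_restrict_mem ho.measurableSet] with x hx using hlimF f x hx

end Limit

/-! ### The weighted estimate. -/

theorem theorem7p2 (d m : ℕ) (μ : ℝ) (hμ : 0 < μ) (M : ℝ≥0) (c₀ : ℝ) (hc₀ : 0 < c₀) :
    ∃ κ ∈ Set.Ioo (0 : ℝ) (1 / 2), ∃ C : ℝ, 0 < C ∧
      ∀ Ω : Set (EuclideanSpace ℝ (Fin d)), IsBoundedLipschitz M c₀ Ω →
      ∀ A : Fin m → Fin m → Fin d → Fin d → EuclideanSpace ℝ (Fin d) → ℝ, IsElliptic μ A →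
      ∀ (u : Fin m → EuclideanSpace ℝ (Fin d) → ℝ)
        (G f : Fin m → Fin d → EuclideanSpace ℝ (Fin d) → ℝ),
        (∀ α i, MemLp (f α i) 2 (volume.restrict Ω)) →
        (∀ α, MemH10 Ω (u α) (G α)) →
        IsWeakSolution Ω A G f →
        ∀ σ : ℝ, |σ| ≤ 2 * κ →
          weightedEnergy Ω σ G ≤ ENNReal.ofReal C * weightedEnergy Ω σ f := by
  rcases Nat.eq_zero_or_pos d with rfl | hd
  · refine ⟨1 / 4, by norm_num, 1, one_pos, fun Ω _ A _ u G f _ _ _ σ _ => ?_⟩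
    simp [weightedEnergy]
  obtain ⟨CH, hCH, hHardy⟩ := exists_hardy_const hd M c₀ hc₀
  set a : ℝ := 1 + 4 * CH * d with ha
  set b : ℝ := 1 + ((m * d) ^ 2 * μ⁻¹ ^ 2 + 8 * d * CH) with hb
  have ha0 : 0 < a := by positivity
  have hb0 : 0 < b := by positivity
  -- With `p = σ / 2`, so that `|p| ≤ κ`, the entries `1 / 4`, `1 / a` and `μ / 4 / b` yield the
  -- smallness conditions `hp1`, `hp2` and `hp3` respectively; the first also keeps `κ` below `1 /
  -- 2`.
  refine ⟨min (1 / 4) (min (1 / a) (μ / 4 / b)), ⟨by positivity, ?_⟩, 2 / μ * (1 / μ + 1),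
    by positivity, ?_⟩
  · exact (min_le_left _ _).trans_lt (by norm_num)
  intro Ω hΩ A hA u G f hf hu hsol σ hσ
  have hσ' : |σ / 2| ≤ min (1 / 4) (min (1 / a) (μ / 4 / b)) := by
    rw [abs_div, abs_two]
    linarith
  obtain ⟨h1, h2, h3⟩ : |σ / 2| ≤ 1 / 4 ∧ |σ / 2| ≤ 1 / a ∧ |σ / 2| ≤ μ / 4 / b := by
    simpa only [le_min_iff] using hσ'
  rw [le_div_iff₀ ha0] at h2
  rw [le_div_iff₀ hb0] at h3
  have h0 := abs_nonneg (σ / 2)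
  refine weightedEnergy_le_of_forall_smooth hd hΩ.isBounded hΩ.isOpen hf (by positivity)
    fun ζ hζ hpos hζ1 hζδ => ?_
  exact hsol.smooth_weighted_estimate hΩ.isBounded hΩ.isOpen hμ hA hf hu hCH.le (hHardy Ω hΩ)
    hζ hpos hζ1 hζδ (by linarith) (by rw [ha] at h2; linarith) (by rw [hb] at h3; linarith)
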